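/- Let $d\ge 0$ and let $(J_{x,y})$ be real coupling constants indexed by unordered pairs $\{x,y\}$ of points of $\mathbb{Z}^d$, such that: $J_{x,y}=J_{0,y-x}$ for all $x,y$; $J_{x,y}\ge 0$; $\sum_{x\in\mathbb{Z}^d}J_{0,x}<\infty$; and for every $x\in\mathbb{Z}^d$ there are $0=x_0,x_1,\dots,x_m=x$ with $J_{x_{i},x_{i+1}}>0$ for all $0\le i<m$. Let $\beta>0$. For a set $V$ let $\mathcal{P}_2(V)$ be the set of unordered pairs (edges) $\{x,y\}$ of distinct points of $V$ and $\Omega_V=\{0,1,2,\dots\}^{\mathcal{P}_2(V)}$ the set of currents on $V$, with the product $\sigma$-algebra. Let $G\subset\mathbb{Z}^d$ be finite, let $\delta\notin\mathbb{Z}^d$ be an additional vertex, and set $J_{x,\delta}=\sum_{y\in\mathbb{Z}^d\setminus G}J_{x,y}$ for $x\in G$. For a current $\mathbf n$ on $V=G$ or $V=G\cup\{\delta\}$ put $w_\beta(\mathbf n)=\prod_{e\in\mathcal{P}_2(V)}(\beta J_e)^{\mathbf n_e}/\mathbf n_e!$ and let $\partial\mathbf n$ be the set of the $x\in G$ for which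 $\sum_{y\in V\setminus\{x\}}\mathbf n_{x,y}$ is odd ($\delta$ is never counted as a source). Let $\mathrm P^0_{G,\beta}$, respectively $\mathrm P^+_{G,\beta}$, be the probability measure on $\Omega_G$, respectively on $\Omega_{G\cup\{\delta\}}$, that is supported on $\{\partial\mathbf n=\emptyset\}$ and gives each $\mathbf n$ there a probability proportional to $w_\beta(\mathbf n)$. Let $\widehat{\mathrm P}^0_{G,\beta}$ and $\widehat{\mathrm P}^+_{G,\beta}$ be the laws on $\Omega_{\mathbb{Z}^d}$ that these induce when the values on the edges containing $\delta$ are forgotten and currents on $G$ are extended by $0$ to the pairs of $\mathbb{Z}^d$ not contained in $G$. Let $\Lambda_L=[-L,L]^d\cap\mathbb{Z}^d$, and for $x\in\mathbb{Z}^d$ define the shift $\tau_x$ by $\tau_x(\omega)_{a,b}=\omega_{a+x,b+x}$. Then there are two probability measures $\widehat{\mathrm P}^+_\beta$ and $\widehat{\mathrm P}^0_\beta$ on $\Omega_{\mathbb{Z}^d}$ such that, for $\#\in\{+,0\}$: 1. (Convergence) for every event $\mathcal A\subset\Omega_{\mathbb{Z}^d}$ depending on finitely many edges, $\lim_{L\to\infty}\widehat{\mathrm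 P}^\#_{\Lambda_L,\beta}[\mathcal A]=\widehat{\mathrm P}^\#_\beta[\mathcal A]$; 2. (Translation invariance) $\widehat{\mathrm P}^\#_\beta$ is invariant under $\tau_x$ for every $x\in\mathbb{Z}^d$; 3. (Ergodicity) $\widehat{\mathrm P}^\#_\beta$ is ergodic with respect to the group of shifts $(\tau_x)_{x\in\mathbb{Z}^d}$. The same three properties hold for the laws of the traced currents, that is, with all the measures above replaced by their images on $\{0,1\}^{\mathcal{P}_2(\mathbb{Z}^d)}$ under the map $\mathbf n\mapsto(\mathbf 1\{\mathbf n_e>0\})_{e}$. -/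

import Mathlib

open MeasureTheory Filter Topology
open scoped Nat

noncomputable section

namespace RandomCurrent

/-- The vertices of the lattice `ℤ^d`. -/
abbrev Site (d : ℕ) : Type := Fin d → ℤ

/-- The unordered pairs `{x, y}`, `x ≠ y`, of elements of `V`. -/
abbrev Edge (V : Type) : Type := {e : Sym2 V // ¬ e.IsDiag}

/-- The map on edges induced by an injection on vertices. -/
def Edge.map {V W : Type} (f : V ↪ W) (e : Edge V) : Edge W :=
  ⟨e.1.map f, fun h => e.2 ((Sym2.isDiag_map f.injective).1 h)⟩

/-- Currents on `V`: integer valued functions of the edges. -/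
abbrev Current (V : Type) : Type := Edge V → ℕ

/-- Percolation configurations on `V`: `true` means open, `false` closed. -/
abbrev Percolation (V : Type) : Type := Edge V → Bool

/-- The trace of a current: an edge is open when the current through it is positive. -/
def trace {V : Type} (n : Current V) : Percolation V := fun e => decide (0 < n e)

/-- The conditions on the coupling constants, which are indexed by unordered pairs. -/
structure IsCoupling {d : ℕ} (J : Sym2 (Site d) → ℝ) : Prop where
  /-- translation invariant -/
  translation : ∀ x y : Site d, J s(x, y) = J s(0, y - x)
  /-- ferromagnetic -/
  nonneg : ∀ x y : Site d, 0 ≤ J s(x, y)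
  /-- locally finite -/
  summable : Summable fun x : Site d => J s(0, x)
  /-- aperiodic: every vertex is reached from `0` by steps of positive coupling -/
  aperiodic : ∀ x : Site d, Relation.ReflTransGen (fun a b => 0 < J s(a, b)) 0 x

section FiniteGraph

variable {V : Type} [Fintype V] [DecidableEq V]

/-- The sources of a current: the vertices at which the total current is odd. -/
def sources (n : Current V) : Set V :=
  {x | Odd (∑ e : Edge V, if x ∈ e.1 then n e else 0)}

/-- The weight `∏ (β K_e)^{n_e} / n_e!` of a current. -/
def weight (β : ℝ) (K : Edge V → ℝ) (n : Current V) : ℝ :=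
  ∏ e : Edge V, (β * K e) ^ n e / (n e)!

/-- The law on currents in `S` with probabilities proportional to the weights. -/
def lawOn (β : ℝ) (K : Edge V → ℝ) (S : Set (Current V)) : Measure (Current V) :=
  Measure.sum fun n : Current V =>
    ENNReal.ofReal (S.indicator (weight β K) n / ∑' m : Current V, S.indicator (weight β K) m) •
      Measure.dirac n

end FiniteGraph

section FiniteVolume

variable {d : ℕ} (J : Sym2 (Site d) → ℝ) (β : ℝ) (G : Finset (Site d))

/-- The coupling constants between the vertices of `G`. -/
def freeCoupling (e : Edge G) : ℝ := J (e.1.map Subtype.val)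

/-- The coupling `∑_{y ∉ G} J_{x,y}` of a vertex `x` of `G` to the ghost vertex. -/
def ghostCoupling (x : Site d) : ℝ := ∑' y : {y : Site d // y ∉ G}, J s(x, y.1)

/-- The coupling constants on `G ∪ {δ}`; the ghost vertex `δ` is `none`. -/
def plusCoupling (e : Edge (Option G)) : ℝ :=
  Sym2.lift ⟨fun a b : Option G =>
    match a, b with
    | some x, some y => J s(x.1, y.1)
    | some x, none => ghostCoupling J G x.1
    | none, some y => ghostCoupling J G y.1
    | none, none => 0, by
      rintro (_ | x) (_ | y)
      · rfl
      · rfl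
      · rfl
      · exact congrArg J Sym2.eq_swap⟩ e.1

/-- The law of sourceless currents on `G`. -/
def freeLaw : Measure (Current G) :=
  lawOn β (freeCoupling J G) {n | sources n = ∅}

/-- The law of sourceless currents on `G ∪ {δ}`, where `δ` is never listed among the sources. -/
def plusLaw : Measure (Current (Option G)) :=
  lawOn β (plusCoupling J G) {n | {x : G | some x ∈ sources n} = ∅}

/-- A current on `G` as a current on `ℤ^d` that vanishes on the pairs not contained in `G`. -/
def extendCurrent (n : Current G) : Current (Site d) :=
  Function.extend (Edge.map (Function.Embedding.subtype (· ∈ G))) n 0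

/-- The restriction to the pairs of `G` of a current on `G ∪ {δ}`. -/
def forgetGhost (n : Current (Option G)) : Current G :=
  fun e => n (e.map Function.Embedding.some)

/-- The box `[-L, L]^d`. -/
def box (d L : ℕ) : Finset (Site d) := Finset.Icc (fun _ => -(L : ℤ)) (fun _ => (L : ℤ))

/-- The law of the random current in the box with free boundary conditions, as a law on currents
on `ℤ^d`. -/
def freeBoxLaw (L : ℕ) : Measure (Current (Site d)) :=
  (freeLaw J β (box d L)).map (extendCurrent (box d L))

/-- The law on the lattice edges of the random current in the box with `+` boundary conditions,
as a law on currents on `ℤ^d`. -/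
def plusBoxLaw (L : ℕ) : Measure (Current (Site d)) :=
  (plusLaw J β (box d L)).map fun n => extendCurrent (box d L) (forgetGhost (box d L) n)

end FiniteVolume

section InfiniteVolume

variable {d : ℕ} {S : Type}

/-- The shift `(τ_x ω)_{a,b} = ω_{a+x,b+x}`. -/
def shift (x : Site d) (ω : Edge (Site d) → S) : Edge (Site d) → S :=
  fun e => ω (e.map (Equiv.addRight x).toEmbedding)

/-- The action of `ℤ^d` on configurations by shifts. -/
abbrev shiftAction (d : ℕ) (S : Type) : VAdd (Site d) (Edge (Site d) → S) := ⟨shift⟩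

/-- `μ` is a translation invariant and ergodic law, and `ν L` converges to it, as `L → ∞`, on the
events that depend on finitely many edges. -/
structure IsErgodicLimit [MeasurableSpace S] (ν : ℕ → Measure (Edge (Site d) → S))
    (μ : Measure (Edge (Site d) → S)) : Prop where
  isProbability : IsProbabilityMeasure μ
  convergence : ∀ (E : Finset (Edge (Site d))) (A : Set (Edge (Site d) → S)),
    DependsOn (fun ω => ω ∈ A) (E : Set (Edge (Site d))) →
      Tendsto (fun L => ν L A) atTop (𝓝 (μ A))
  invariance : ∀ x : Site d, MeasurePreserving (shift x) μ μ
  ergodicity : letI := shiftAction d S; ErgodicVAdd (Site d) (Edge (Site d) → S) μ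

end InfiniteVolume

end RandomCurrent

end

/-! Currents are turned into Ising observables. Writing the parity constraints as an average over
spins makes the sum over currents factor over the edges, so the probability that a sourceless
current takes prescribed values on a finite edge set `E` is the Ising mean of a product of one-edge
functions `currentFactor` of σ_xσ_y (`hasSum_indicator_weight`, `lawOn_cylinder`). A ghost vertex
that may be a source is a spin fixed to 1, i.e. the plus boundary condition. The product expands in
the observables `obs S`, `S ⊆ E`, and only edges of positive coupling occur in it
(`exists_cylFun_eq`).

Convergence and invariance: by Ginibre's inequality the means of `obs S` increase with the volume
for free and decrease for plus boundary conditions. They converge along all finite sets, hence also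
along translated boxes. Tightness, from the exponential series at each edge, turns convergent
cylinder probabilities into a limit law.

Ergodicity rests on a one-sided large deviation bound. The free correlation at β is a supremum over
volumes of functions continuous in β, so it is nearly attained at some β' < β. Multiplying the
weight at β by factors 1 - a·`obs`, over disjoint translates and with a small, costs less than the
gap in couplings between β and β': Ginibre's condition survives
(`isingWeight_mul_prod_mem_posType`), and the tilted correlations stay above those at β'.
Integrating the factors one at a time bounds the mean of their product (`isingMean_prod_le`). For
plus boundary conditions the same works from above, with β' > β. A one-sided exponential bound
together with convergence of the mean gives concentration of averages over disjoint translates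
(`isingMean_abs_le_of_prod_le`). So the averages of indicators of translated cylinder events have
small variance, an invariant event is independent of every cylinder event, hence of itself. The
trace commutes with shifts and inherits everything. -/

noncomputable section

namespace RandomCurrent

/-! ### Signs and functions of positive type -/

/-- The real number attached to a sign. -/
def sgn (u : ℤˣ) : ℝ := ((u : ℤ) : ℝ)

@[simp] lemma sgn_one : sgn 1 = 1 := by simp [sgn]

@[simp] lemma sgn_neg_one : sgn (-1) = -1 := by simp [sgn]

lemma sgn_mul (u v : ℤˣ) : sgn (u * v) = sgn u * sgn v := by simp [sgn]

lemma sgn_prod {ι : Type*} (s : Finset ι) (u : ι → ℤˣ) : sgn (∏ i ∈ s, u i) = ∏ i ∈ s, sgn (u i) := by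
  classical
  induction s using Finset.induction_on with
  | empty => simp
  | insert a s ha ih => rw [Finset.prod_insert ha, Finset.prod_insert ha, sgn_mul, ih]

lemma sgn_pow (u : ℤˣ) (n : ℕ) : sgn (u ^ n) = sgn u ^ n := by simp [sgn]

lemma sgn_eq (u : ℤˣ) : sgn u = 1 ∨ sgn u = -1 := by
  rcases Int.units_eq_one_or u with rfl | rfl <;> simp

lemma abs_sgn (u : ℤˣ) : |sgn u| = 1 := by rcases sgn_eq u with h | h <;> simp [h]

lemma sgn_le_one (u : ℤˣ) : sgn u ≤ 1 := by rcases sgn_eq u with h | h <;> simp [h]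

lemma neg_one_le_sgn (u : ℤˣ) : -1 ≤ sgn u := by rcases sgn_eq u with h | h <;> simp [h]

lemma sgn_mul_self (u : ℤˣ) : sgn u * sgn u = 1 := by rcases sgn_eq u with h | h <;> simp [h]

lemma exp_mul_sgn (c : ℝ) (u : ℤˣ) :
    Real.exp (c * sgn u) = Real.cosh c + Real.sinh c * sgn u := by
  rcases sgn_eq u with h | h <;> rw [h]
  · rw [mul_one, mul_one, Real.cosh_add_sinh]
  · rw [mul_neg_one, mul_neg_one, ← sub_eq_add_neg, Real.cosh_sub_sinh]

section PosType

variable {X : Type*} [CommGroup X]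

/-- The functions that are nonnegative combinations of `±1`-valued characters. -/
def posType (X : Type*) [CommGroup X] : Subalgebra NNReal (X → ℝ) :=
  Algebra.adjoin NNReal (Set.range fun (χ : X →* ℤˣ) (σ : X) => sgn (χ σ))

lemma char_mem_posType (χ : X →* ℤˣ) : (fun σ => sgn (χ σ)) ∈ posType X :=
  Algebra.subset_adjoin ⟨χ, rfl⟩

lemma const_mul_mem_posType {c : ℝ} (hc : 0 ≤ c) {f : X → ℝ} (hf : f ∈ posType X) :
    (fun σ => c * f σ) ∈ posType X :=
  (posType X).smul_mem hf (⟨c, hc⟩ : NNReal)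

lemma const_mem_posType {c : ℝ} (hc : 0 ≤ c) : (fun _ => c) ∈ posType X := by
  simpa using const_mul_mem_posType hc (one_mem (posType X))

lemma mul_mem_posType {f g : X → ℝ} (hf : f ∈ posType X) (hg : g ∈ posType X) :
    (fun σ => f σ * g σ) ∈ posType X := mul_mem hf hg

lemma add_mem_posType {f g : X → ℝ} (hf : f ∈ posType X) (hg : g ∈ posType X) :
    (fun σ => f σ + g σ) ∈ posType X := add_mem hf hg

lemma prod_mem_posType {ι : Type*} {s : Finset ι} {f : ι → X → ℝ} (hf : ∀ i ∈ s, f i ∈ posType X) :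
    (fun σ => ∏ i ∈ s, f i σ) ∈ posType X := by
  have := prod_mem hf
  convert this using 1
  ext σ
  simp

lemma exp_mem_posType {c : ℝ} (hc : 0 ≤ c) (χ : X →* ℤˣ) :
    (fun σ => Real.exp (c * sgn (χ σ))) ∈ posType X := by
  simp_rw [exp_mul_sgn]
  exact add_mem_posType (const_mem_posType (Real.cosh_pos c).le)
    (const_mul_mem_posType (Real.sinh_nonneg_iff.2 hc) (char_mem_posType χ))

lemma exp_sum_mem_posType {ι : Type*} {s : Finset ι} {c : ι → ℝ} (hc : ∀ i ∈ s, 0 ≤ c i)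
    (χ : ι → X →* ℤˣ) :
    (fun σ => Real.exp (∑ i ∈ s, c i * sgn (χ i σ))) ∈ posType X := by
  simp_rw [Real.exp_sum]
  exact prod_mem_posType fun i hi => exp_mem_posType (hc i hi) (χ i)

/-- Telescoping: changing one factor at a time leaves a difference of positive type multiplied by
functions of positive type. -/
lemma prod_sub_prod_mem_posType {ι : Type*} (s : Finset ι) {f g : ι → X → ℝ}
    (hf : ∀ i ∈ s, f i ∈ posType X) (hg : ∀ i ∈ s, g i ∈ posType X)
    (hfg : ∀ i ∈ s, (fun σ => f i σ - g i σ) ∈ posType X) :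
    (fun σ => ∏ i ∈ s, f i σ - ∏ i ∈ s, g i σ) ∈ posType X := by
  classical
  induction s using Finset.induction_on with
  | empty => simpa using const_mem_posType (X := X) le_rfl
  | insert a s ha ih =>
    simp only [Finset.mem_insert, forall_eq_or_imp] at hf hg hfg
    have h1 := mul_mem_posType hf.1 (ih hf.2 hg.2 hfg.2)
    have h2 := mul_mem_posType hfg.1 (prod_mem_posType hg.2)
    convert add_mem_posType h1 h2 using 1
    ext σ
    rw [Finset.prod_insert ha, Finset.prod_insert ha]
    ring

/-- A strictly ferromagnetic weight stays of positive type under a small many-body perturbation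
of any sign. -/
lemma exp_sum_mul_one_add_mem_posType {ι : Type*} (s : Finset ι) {c u : ℝ} (hc : 0 < c)
    (hu : |u| ≤ Real.tanh c ^ s.card) (χ : ι → X →* ℤˣ) :
    (fun σ => Real.exp (∑ i ∈ s, c * sgn (χ i σ)) * (1 + u * ∏ i ∈ s, sgn (χ i σ))) ∈
      posType X := by
  have hG := exp_sum_mem_posType (s := s) (c := fun _ => c) (fun _ _ => hc.le) χ
  have hP : (fun σ => ∏ i ∈ s, sgn (χ i σ)) ∈ posType X :=
    prod_mem_posType fun i _ => char_mem_posType (χ i)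
  rcases le_or_gt 0 u with h0 | h0
  · exact mul_mem_posType hG
      (add_mem_posType (const_mem_posType zero_le_one) (const_mul_mem_posType h0 hP))
  -- For negative u the factor itself is not of positive type, and the exponential weight has to
  -- compensate: it dominates its own product with θ^k ∏ χ_i, where k = `s.card`.
  set θ := Real.tanh c with hθ
  have hθ0 : 0 < θ := by
    rw [hθ, Real.tanh_eq_sinh_div_cosh]; exact div_pos (Real.sinh_pos_iff.2 hc) (Real.cosh_pos c)
  have hdiff : (fun σ => ∏ i ∈ s, Real.exp (c * sgn (χ i σ)) -
      ∏ i ∈ s, (θ * (sgn (χ i σ) * Real.exp (c * sgn (χ i σ))))) ∈ posType X := by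
    refine prod_sub_prod_mem_posType s (fun i _ => exp_mem_posType hc.le (χ i))
      (fun i _ => const_mul_mem_posType hθ0.le
        (mul_mem_posType (char_mem_posType (χ i)) (exp_mem_posType hc.le (χ i)))) fun i _ => ?_
    -- With χ² = 1 the χ-terms of cosh c + χ sinh c and tanh c · (χ cosh c + sinh c) cancel, which
    -- is why θ is tanh c.
    have : (fun σ => Real.exp (c * sgn (χ i σ)) - θ * (sgn (χ i σ) * Real.exp (c * sgn (χ i σ)))) =
        fun _ => 1 / Real.cosh c := by
      ext σ
      have h1 := sgn_mul_self (χ i σ)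
      have h2 := Real.cosh_sq c
      have h3 := (Real.cosh_pos c).ne'
      rw [exp_mul_sgn, hθ, Real.tanh_eq_sinh_div_cosh]
      field_simp
      linear_combination h2 - Real.sinh c ^ 2 * h1
    rw [this]
    exact const_mem_posType (one_div_pos.2 (Real.cosh_pos c)).le
  set r := -u / θ ^ s.card with hr
  have hθs : 0 < θ ^ s.card := pow_pos hθ0 _
  have hr0 : 0 ≤ r := div_nonneg (by linarith) hθs.le
  have hr1 : r ≤ 1 := by rw [hr, div_le_one hθs]; rwa [abs_of_neg h0] at hu
  -- With u = -rθ^k, weight G and product P of the characters: G(1 + uP) = (1 - r)G + r(G - θ^k P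
  -- G).
  convert add_mem_posType (const_mul_mem_posType (sub_nonneg.2 hr1) hG)
    (const_mul_mem_posType hr0 hdiff) using 1
  ext σ
  have hu' : u = -(r * θ ^ s.card) := by rw [hr]; field_simp
  rw [Finset.prod_mul_distrib, Finset.prod_mul_distrib, Finset.prod_const, ← Real.exp_sum, hu']
  ring

/-! ### Correlation inequalities -/

variable {C : Finset X}

lemma sum_mul_left_of_mul_mem (hC : ∀ a ∈ C, ∀ b ∈ C, a * b ∈ C) {a : X} (ha : a ∈ C)
    (f : X → ℝ) : ∑ σ ∈ C, f (a * σ) = ∑ σ ∈ C, f σ := by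
  refine Finset.sum_nbij (fun σ => a * σ) (fun σ hσ => hC a ha σ hσ)
    (fun _ _ _ _ h => mul_left_cancel h) ?_ (fun _ _ => rfl)
  exact Finset.surjOn_of_injOn_of_card_le _ (fun σ hσ => hC a ha σ hσ)
    (fun _ _ _ _ h => mul_left_cancel h) le_rfl

lemma sum_sgn_eq_zero (hC : ∀ a ∈ C, ∀ b ∈ C, a * b ∈ C) (χ : X →* ℤˣ) {a : X} (ha : a ∈ C)
    (h : χ a = -1) : ∑ σ ∈ C, sgn (χ σ) = 0 := by
  have := sum_mul_left_of_mul_mem hC ha fun σ => sgn (χ σ)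
  simp_rw [map_mul, sgn_mul, h, sgn_neg_one, neg_one_mul, Finset.sum_neg_distrib] at this
  linarith

/-- Orthogonality of characters: if χ takes the value -1 on C the terms cancel, otherwise they are
all 1. -/
lemma sum_sgn_nonneg (hC : ∀ a ∈ C, ∀ b ∈ C, a * b ∈ C) (χ : X →* ℤˣ) :
    0 ≤ ∑ σ ∈ C, sgn (χ σ) := by
  by_cases h : ∃ a ∈ C, χ a = -1
  · obtain ⟨a, ha, h⟩ := h
    exact (sum_sgn_eq_zero hC χ ha h).ge
  · push Not at h
    refine Finset.sum_nonneg fun σ hσ => ?_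
    rw [(Int.units_eq_one_or (χ σ)).resolve_right (h σ hσ), sgn_one]
    exact zero_le_one

/-- Products of characters are characters, so the generated algebra is just the cone they span, and
nonnegativity need only be checked on a single character. -/
lemma sum_nonneg_of_mem_posType (hC : ∀ a ∈ C, ∀ b ∈ C, a * b ∈ C) {f : X → ℝ}
    (hf : f ∈ posType X) : 0 ≤ ∑ σ ∈ C, f σ := by
  have hf' : f ∈ Submodule.span NNReal
      (Submonoid.closure (Set.range fun (χ : X →* ℤˣ) (σ : X) => sgn (χ σ)) : Set (X → ℝ)) := by
    rw [← Algebra.adjoin_eq_span]; exact hf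
  clear hf
  induction hf' using Submodule.span_induction with
  | mem f h =>
    have : ∃ χ : X →* ℤˣ, f = fun σ => sgn (χ σ) := by
      induction h using Submonoid.closure_induction with
      | mem f h => obtain ⟨χ, rfl⟩ := h; exact ⟨χ, rfl⟩
      | one => exact ⟨1, by ext; simp⟩
      | mul f g _ _ hf hg =>
        obtain ⟨χ, rfl⟩ := hf
        obtain ⟨ψ, rfl⟩ := hg
        exact ⟨χ * ψ, by ext; simp [sgn_mul]⟩
    obtain ⟨χ, rfl⟩ := this
    exact sum_sgn_nonneg hC χ
  | zero => simp
  | add f g _ _ hf hg =>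
    simp only [Pi.add_apply, Finset.sum_add_distrib]
    exact add_nonneg hf hg
  | smul c f _ hf =>
    simp only [Pi.smul_apply, ← Finset.smul_sum]
    exact smul_nonneg c.2 hf

/-- Comparison of the mean values of a character under two weights, by duplication of
variables. -/
lemma sum_char_mul_le (hC : ∀ a ∈ C, ∀ b ∈ C, a * b ∈ C) {w w' : X → ℝ}
    (hw : ∀ ρ ∈ C, (fun σ => w σ * w' (σ * ρ)) ∈ posType X) (χ : X →* ℤˣ) :
    (∑ σ ∈ C, sgn (χ σ) * w' σ) * ∑ σ ∈ C, w σ ≤ (∑ σ ∈ C, sgn (χ σ) * w σ) * ∑ σ ∈ C, w' σ := by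
  -- Ginibre's substitution σ' = σρ in the double sum of (χ(σ) - χ(σ')) w(σ) w'(σ'): for fixed ρ the
  -- summand is of positive type in σ.
  have key : 0 ≤ ∑ ρ ∈ C, ∑ σ ∈ C, (1 - sgn (χ ρ)) * (sgn (χ σ) * (w σ * w' (σ * ρ))) :=
    Finset.sum_nonneg fun ρ hρ => sum_nonneg_of_mem_posType hC <|
      const_mul_mem_posType (sub_nonneg.2 (sgn_le_one _))
        (mul_mem_posType (char_mem_posType χ) (hw ρ hρ))
  have h2 : ∑ ρ ∈ C, ∑ σ ∈ C, (1 - sgn (χ ρ)) * (sgn (χ σ) * (w σ * w' (σ * ρ))) =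
      ∑ σ ∈ C, ∑ σ' ∈ C, (sgn (χ σ) - sgn (χ σ')) * (w σ * w' σ') := by
    rw [Finset.sum_comm]
    refine Finset.sum_congr rfl fun σ hσ => ?_
    rw [← sum_mul_left_of_mul_mem hC hσ fun σ' => (sgn (χ σ) - sgn (χ σ')) * (w σ * w' σ')]
    refine Finset.sum_congr rfl fun ρ _ => ?_
    rw [map_mul, sgn_mul]
    ring
  rw [h2] at key
  have h3 : ∑ σ ∈ C, ∑ σ' ∈ C, (sgn (χ σ) - sgn (χ σ')) * (w σ * w' σ') =
      (∑ σ ∈ C, sgn (χ σ) * w σ) * ∑ σ ∈ C, w' σ -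
        (∑ σ ∈ C, sgn (χ σ) * w' σ) * ∑ σ ∈ C, w σ := by
    rw [mul_comm (∑ σ ∈ C, sgn (χ σ) * w' σ), Finset.sum_mul_sum, Finset.sum_mul_sum,
      ← Finset.sum_sub_distrib]
    refine Finset.sum_congr rfl fun σ _ => ?_
    rw [← Finset.sum_sub_distrib]
    exact Finset.sum_congr rfl fun σ' _ => by ring
  linarith

end PosType

/-! ### Spin configurations -/

section Spin

variable {V W : Type}

/-- The product of the spins at the ends of an edge, as a character. -/
def bond (e : Sym2 V) : (V → ℤˣ) →* ℤˣ :=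
  Sym2.lift ⟨fun x y => Pi.evalMonoidHom (fun _ : V => ℤˣ) x * Pi.evalMonoidHom (fun _ => ℤˣ) y,
    fun _ _ => mul_comm _ _⟩ e

@[simp] lemma bond_mk (x y : V) (σ : V → ℤˣ) : bond s(x, y) σ = σ x * σ y := rfl

lemma bond_map (f : V → W) (e : Sym2 V) (σ : W → ℤˣ) : bond (e.map f) σ = bond e (σ ∘ f) := by
  induction e using Sym2.ind with
  | _ x y => simp

lemma Edge.map_injective (f : V ↪ W) : Function.Injective (Edge.map f) := by
  intro a b h
  exact Subtype.ext (Sym2.map.injective f.injective (congrArg Subtype.val h))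

/-- The product of the edge spins over a finite set of edges. -/
def obs (S : Finset (Edge V)) (σ : V → ℤˣ) : ℝ := ∏ e ∈ S, sgn (bond e.1 σ)

variable [DecidableEq V]

lemma bond_mulSingle (e : Edge V) (z : V) :
    bond e.1 (Pi.mulSingle z (-1)) = if z ∈ e.1 then -1 else 1 := by
  obtain ⟨e, he⟩ := e
  induction e using Sym2.ind with
  | _ x y =>
    have hxy : x ≠ y := by simpa using he
    by_cases hx : z = x
    · subst hx; simp [hxy.symm]
    · by_cases hy : z = y
      · subst hy; simp [hxy]
      · simp [hx, hy, Ne.symm hx, Ne.symm hy]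

/-- The spin configurations that are `1` outside a finite set. -/
def spinConfigs (G : Finset V) : Finset (V → ℤˣ) :=
  open scoped Classical in
  G.powerset.image fun S x => if x ∈ S then -1 else 1

lemma mem_spinConfigs {G : Finset V} {σ : V → ℤˣ} : σ ∈ spinConfigs G ↔ ∀ x ∉ G, σ x = 1 := by
  simp only [spinConfigs, Finset.mem_image, Finset.mem_powerset]
  constructor
  · rintro ⟨S, hS, rfl⟩ x hx
    exact if_neg fun h => hx (hS h)
  · intro h
    refine ⟨G.filter fun x => σ x = -1, Finset.filter_subset _ _, ?_⟩
    ext x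
    by_cases hx : x ∈ G
    · rcases Int.units_eq_one_or (σ x) with h1 | h1 <;> simp [hx, h1]
    · simp [hx, h x hx]

lemma mul_mem_spinConfigs {G : Finset V} :
    ∀ σ ∈ spinConfigs G, ∀ τ ∈ spinConfigs G, σ * τ ∈ spinConfigs G := by
  intro σ hσ τ hτ
  rw [mem_spinConfigs] at *
  intro x hx
  rw [Pi.mul_apply, hσ x hx, hτ x hx, one_mul]

lemma one_mem_spinConfigs (G : Finset V) : (1 : V → ℤˣ) ∈ spinConfigs G :=
  mem_spinConfigs.2 fun _ _ => rfl

lemma mulSingle_mem_spinConfigs {G : Finset V} {z : V} (hz : z ∈ G) (u : ℤˣ) :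
    Pi.mulSingle z u ∈ spinConfigs G :=
  mem_spinConfigs.2 fun x hx => Pi.mulSingle_eq_of_ne (by rintro rfl; exact hx hz) _

/-- (1 + σ_z)/2 is the indicator of σ_z = 1. In this form, fixing a spin is multiplication by a
function of positive type. -/
lemma sum_spinConfigs_eq_sum_insert {G : Finset V} {z : V} (hz : z ∉ G) (F : (V → ℤˣ) → ℝ) :
    ∑ σ ∈ spinConfigs G, F σ = ∑ σ ∈ spinConfigs (insert z G), (1 + sgn (σ z)) / 2 * F σ := by
  have h : spinConfigs G = (spinConfigs (insert z G)).filter fun σ => σ z = 1 := by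
    ext σ
    simp only [Finset.mem_filter, mem_spinConfigs, Finset.mem_insert]
    constructor
    · exact fun h => ⟨fun x hx => h x fun h' => hx (Or.inr h'), h z hz⟩
    · rintro ⟨h, h'⟩ x hx
      by_cases hxz : x = z
      · rw [hxz, h']
      · exact h x (by tauto)
  rw [h, Finset.sum_filter]
  refine Finset.sum_congr rfl fun σ _ => ?_
  rcases Int.units_eq_one_or (σ z) with h | h
  · simp [h]
  · simp [h, show (-1 : ℤˣ) ≠ 1 by decide]

lemma sum_spinConfigs_insert {G : Finset V} {z : V} (hz : z ∉ G) {F : (V → ℤˣ) → ℝ}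
    (hF : ∀ σ, F (Pi.mulSingle z (-1) * σ) = F σ) :
    ∑ σ ∈ spinConfigs (insert z G), F σ = 2 * ∑ σ ∈ spinConfigs G, F σ := by
  rw [sum_spinConfigs_eq_sum_insert hz]
  have h := sum_mul_left_of_mul_mem (mul_mem_spinConfigs (G := insert z G))
    (mulSingle_mem_spinConfigs (Finset.mem_insert_self z G) (-1)) fun σ => sgn (σ z) * F σ
  simp_rw [Pi.mul_apply, sgn_mul, hF, Pi.mulSingle_eq_same, sgn_neg_one, neg_one_mul, neg_mul,
    Finset.sum_neg_distrib] at h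
  have h0 : ∑ σ ∈ spinConfigs (insert z G), sgn (σ z) * F σ = 0 := by linarith
  simp_rw [div_mul_eq_mul_div, add_mul, one_mul, ← Finset.sum_div, Finset.sum_add_distrib, h0]
  ring

lemma sum_spinConfigs_of_subset {G G' : Finset V} (hG : G ⊆ G') {F : (V → ℤˣ) → ℝ}
    (hF : ∀ z ∉ G, ∀ σ, F (Pi.mulSingle z (-1) * σ) = F σ) :
    ∑ σ ∈ spinConfigs G', F σ = 2 ^ (G' \ G).card * ∑ σ ∈ spinConfigs G, F σ := by
  have key : ∀ D : Finset V, Disjoint D G →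
      ∑ σ ∈ spinConfigs (D ∪ G), F σ = 2 ^ D.card * ∑ σ ∈ spinConfigs G, F σ := by
    intro D
    induction D using Finset.induction_on with
    | empty => simp
    | insert a s ha ih =>
      intro hD
      rw [Finset.disjoint_insert_left] at hD
      rw [Finset.insert_union, sum_spinConfigs_insert (by simp [ha, hD.1]) (hF a hD.1), ih hD.2,
        Finset.card_insert_of_notMem ha]
      ring
  rw [← key _ Finset.sdiff_disjoint, Finset.sdiff_union_of_subset hG]

/-! ### Edges of a finite set and products of edge spins -/

/-- The edges contained in a finite set of vertices. -/
def edgesIn (G : Finset V) : Finset (Edge V) :=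
  Finset.univ.map ⟨Edge.map (Function.Embedding.subtype (· ∈ G)), Edge.map_injective _⟩

lemma mem_edgesIn {G : Finset V} {e : Edge V} : e ∈ edgesIn G ↔ ∀ x ∈ e.1, x ∈ G := by
  simp only [edgesIn, Finset.mem_map, Finset.mem_univ, true_and, Function.Embedding.coeFn_mk]
  constructor
  · rintro ⟨e, rfl⟩ x hx
    obtain ⟨y, -, rfl⟩ := Sym2.mem_map.1 hx
    exact y.2
  · intro h
    obtain ⟨e, he⟩ := e
    induction e using Sym2.ind with
    | _ x y =>
      refine ⟨⟨s(⟨x, h x (by simp)⟩, ⟨y, h y (by simp)⟩), ?_⟩, ?_⟩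
      · simpa [Subtype.ext_iff] using he
      · simp [Edge.map]

lemma edgesIn_mono {G G' : Finset V} (h : G ⊆ G') : edgesIn G ⊆ edgesIn G' :=
  fun _ he => mem_edgesIn.2 fun x hx => h (mem_edgesIn.1 he x hx)

lemma sum_edgesIn (G : Finset V) (f : Edge V → ℝ) :
    ∑ e ∈ edgesIn G, f e = ∑ e : Edge G, f (e.map (Function.Embedding.subtype (· ∈ G))) := by
  simp [edgesIn]

lemma sum_edgesIn_insert {G : Finset V} {z : V} (hz : z ∉ G) (f : Sym2 V → ℝ) :
    ∑ e ∈ edgesIn (insert z G), f e.1 = ∑ e ∈ edgesIn G, f e.1 + ∑ x ∈ G, f s(z, x) := by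
  rw [← Finset.sum_filter_add_sum_filter_not _ (fun e : Edge V => z ∉ e.1)]
  congr 1
  · refine Finset.sum_congr ?_ fun _ _ => rfl
    ext e
    simp only [Finset.mem_filter, mem_edgesIn, Finset.mem_insert]
    constructor
    · rintro ⟨h, h'⟩ x hx
      exact (h x hx).resolve_left fun h'' => h' (h'' ▸ hx)
    · exact fun h => ⟨fun x hx => Or.inr (h x hx), fun h' => hz (h z h')⟩
  · symm
    refine Finset.sum_bij (fun x hx => ⟨s(z, x), by
      simpa using fun h : z = x => hz (h ▸ hx)⟩) ?_ ?_ ?_ (fun _ _ => rfl)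
    · intro x hx
      simp [mem_edgesIn, hx]
    · intro x hx y hy h
      simpa [show z ≠ y from fun h => hz (h ▸ hy)] using h
    · rintro ⟨e, he⟩ h
      simp only [Finset.mem_filter, mem_edgesIn, not_not] at h
      obtain ⟨y, rfl⟩ := Sym2.mem_iff_exists.1 h.2
      have hy := h.1 y (by simp)
      have hzy : z ≠ y := by simpa using he
      exact ⟨y, (Finset.mem_insert.1 hy).resolve_left hzy.symm, rfl⟩

end Spin

/-! ### Means of functions of the spins -/

section Mean

variable {X : Type*}

/-- The mean of `f` on the finite set `C` with weight `w`. -/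
def mean (C : Finset X) (w f : X → ℝ) : ℝ := (∑ σ ∈ C, f σ * w σ) / ∑ σ ∈ C, w σ

lemma mean_add (C : Finset X) (w f g : X → ℝ) :
    mean C w (fun σ => f σ + g σ) = mean C w f + mean C w g := by
  simp only [mean, add_mul, Finset.sum_add_distrib, add_div]

lemma mean_const_mul (C : Finset X) (w : X → ℝ) (c : ℝ) (f : X → ℝ) :
    mean C w (fun σ => c * f σ) = c * mean C w f := by
  simp only [mean, mul_assoc, ← Finset.mul_sum, mul_div_assoc]

lemma mean_sum {ι : Type*} (s : Finset ι) (C : Finset X) (w : X → ℝ) (f : ι → X → ℝ) :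
    mean C w (fun σ => ∑ i ∈ s, f i σ) = ∑ i ∈ s, mean C w (f i) := by
  simp only [mean, Finset.sum_mul, ← Finset.sum_div]
  rw [Finset.sum_comm]

lemma mean_const {C : Finset X} {w : X → ℝ} (h : 0 < ∑ σ ∈ C, w σ) (c : ℝ) :
    mean C w (fun _ => c) = c := by
  rw [mean, ← Finset.mul_sum, mul_div_cancel_right₀ _ h.ne']

lemma mean_mono {C : Finset X} {w f g : X → ℝ} (hw : ∀ σ ∈ C, 0 ≤ w σ)
    (h : ∀ σ ∈ C, f σ ≤ g σ) : mean C w f ≤ mean C w g :=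
  div_le_div_of_nonneg_right
    (Finset.sum_le_sum fun σ hσ => mul_le_mul_of_nonneg_right (h σ hσ) (hw σ hσ))
    (Finset.sum_nonneg hw)

/-- Chain rule for tilting; it lets a product of observables be integrated one factor at a time. -/
lemma mean_mul_right (C : Finset X) (w f g : X → ℝ) (h : ∑ σ ∈ C, g σ * w σ ≠ 0) :
    mean C w (fun σ => g σ * f σ) = mean C w g * mean C (fun σ => g σ * w σ) f := by
  simp only [mean]
  rw [mul_comm, div_mul_div_cancel₀ h]
  congr 1
  exact Finset.sum_congr rfl fun _ _ => by ring

/-- Comparison of the mean values of a character under two weights. -/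
lemma mean_char_le_mean_char [CommGroup X] {C : Finset X} (hC : ∀ a ∈ C, ∀ b ∈ C, a * b ∈ C)
    {w w' : X → ℝ} (h0 : 0 < ∑ σ ∈ C, w σ) (h0' : 0 < ∑ σ ∈ C, w' σ)
    (hw : ∀ ρ ∈ C, (fun σ => w σ * w' (σ * ρ)) ∈ posType X) (χ : X →* ℤˣ) :
    mean C w' (fun σ => sgn (χ σ)) ≤ mean C w fun σ => sgn (χ σ) := by
  rw [mean, mean, div_le_div_iff₀ h0' h0]
  exact sum_char_mul_le hC hw χ

end Mean

/-! ### Ising weights -/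

section Ising

variable {V : Type}

/-- The character that gives `obs S`. -/
def obsChar (S : Finset (Edge V)) : (V → ℤˣ) →* ℤˣ := ∏ e ∈ S, bond e.1

lemma obs_eq_sgn (S : Finset (Edge V)) (σ : V → ℤˣ) : obs S σ = sgn (obsChar S σ) := by
  rw [obs, obsChar, ← sgn_prod, MonoidHom.finsetProd_apply]

lemma abs_obs (S : Finset (Edge V)) (σ : V → ℤˣ) : |obs S σ| = 1 := by
  rw [obs_eq_sgn, abs_sgn]

lemma obs_mul (S : Finset (Edge V)) (σ τ : V → ℤˣ) : obs S (σ * τ) = obs S σ * obs S τ := by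
  rw [obs_eq_sgn, obs_eq_sgn, obs_eq_sgn, map_mul, sgn_mul]

lemma obs_eq_fun (S : Finset (Edge V)) : obs S = fun σ => sgn (obsChar S σ) :=
  funext (obs_eq_sgn S)

variable [DecidableEq V]

lemma obs_mulSingle_mul {G : Finset V} {S : Finset (Edge V)} (hS : S ⊆ edgesIn G) {z : V}
    (hz : z ∉ G) (σ : V → ℤˣ) : obs S (Pi.mulSingle z (-1) * σ) = obs S σ := by
  refine Finset.prod_congr rfl fun e he => ?_
  rw [map_mul, bond_mulSingle, if_neg fun h => hz (mem_edgesIn.1 (hS he) z h), one_mul]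

/-- The Ising weight with couplings `β J` and magnetic field `β h` on `G`. -/
def isingWeight (J : Sym2 V → ℝ) (β : ℝ) (h : V → ℝ) (G : Finset V) (σ : V → ℤˣ) : ℝ :=
  Real.exp (∑ e ∈ edgesIn G, β * J e.1 * sgn (bond e.1 σ) + ∑ x ∈ G, β * h x * sgn (σ x))

/-- The mean value of `f` in the Ising model on `G` with couplings `β J` and magnetic
field `β h`. -/
def isingMean (J : Sym2 V → ℝ) (β : ℝ) (h : V → ℝ) (G : Finset V) (f : (V → ℤˣ) → ℝ) : ℝ :=
  mean (spinConfigs G) (isingWeight J β h G) f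

variable {J : Sym2 V → ℝ} {β β' : ℝ} {h : V → ℝ} {G G' : Finset V}

lemma isingWeight_pos (σ : V → ℤˣ) : 0 < isingWeight J β h G σ := Real.exp_pos _

lemma sum_isingWeight_pos (G' : Finset V) : 0 < ∑ σ ∈ spinConfigs G', isingWeight J β h G σ :=
  Finset.sum_pos (fun σ _ => isingWeight_pos σ) ⟨1, one_mem_spinConfigs G'⟩

lemma isingMean_const (c : ℝ) : isingMean J β h G (fun _ => c) = c :=
  mean_const (sum_isingWeight_pos G) c

lemma isingMean_mono {f g : (V → ℤˣ) → ℝ} (hfg : ∀ σ, f σ ≤ g σ) :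
    isingMean J β h G f ≤ isingMean J β h G g :=
  mean_mono (fun σ _ => (isingWeight_pos σ).le) fun σ _ => hfg σ

lemma abs_isingMean_le {f : (V → ℤˣ) → ℝ} {c : ℝ} (hf : ∀ σ, |f σ| ≤ c) :
    |isingMean J β h G f| ≤ c := by
  rw [abs_le]
  constructor
  · rw [← isingMean_const (J := J) (β := β) (h := h) (G := G) (-c)]
    exact isingMean_mono fun σ => (abs_le.1 (hf σ)).1
  · rw [← isingMean_const (J := J) (β := β) (h := h) (G := G) c]
    exact isingMean_mono fun σ => (abs_le.1 (hf σ)).2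

lemma continuous_isingMean (f : (V → ℤˣ) → ℝ) : Continuous fun β => isingMean J β h G f := by
  unfold isingMean mean
  refine Continuous.div ?_ ?_ fun β => (sum_isingWeight_pos G).ne'
  · unfold isingWeight; fun_prop
  · unfold isingWeight; fun_prop

/-- After duplication the variable ρ only modulates the couplings and the field, to β + β'·(±1), so
they stay nonnegative as long as β' ≤ β. -/
lemma isingWeight_mul_isingWeight (J : Sym2 V → ℝ) (β β' : ℝ) (h : V → ℝ) (G : Finset V)
    (σ ρ : V → ℤˣ) :
    isingWeight J β h G σ * isingWeight J β' h G (σ * ρ) =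
      Real.exp (∑ e ∈ edgesIn G, (β + β' * sgn (bond e.1 ρ)) * J e.1 * sgn (bond e.1 σ)) *
        Real.exp (∑ x ∈ G, (β + β' * sgn (ρ x)) * h x *
          sgn (Pi.evalMonoidHom (fun _ : V => ℤˣ) x σ)) := by
  rw [isingWeight, isingWeight, ← Real.exp_add, ← Real.exp_add]
  congr 1
  simp only [map_mul, sgn_mul, Pi.mul_apply, Pi.evalMonoidHom_apply]
  rw [add_add_add_comm, ← Finset.sum_add_distrib, ← Finset.sum_add_distrib]
  congr 1 <;> exact Finset.sum_congr rfl fun _ _ => by ring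

/-- An amount c of the coupling of each edge of `S y` is spent on absorbing the factor of `y`.
Disjointness ensures that no edge pays twice, and the remaining couplings are nonnegative. -/
lemma exp_sum_mul_prod_mem_posType {T : Type*} {t : Finset T} {s : Finset (Edge V)}
    {κ : Edge V → ℝ} (hκ : ∀ e ∈ s, 0 ≤ κ e) {S : T → Finset (Edge V)} (hS : ∀ y ∈ t, S y ⊆ s)
    (hd : (t : Set T).PairwiseDisjoint S) {c : ℝ} (hc : 0 < c)
    (hcκ : ∀ y ∈ t, ∀ e ∈ S y, c ≤ κ e) {u : T → ℝ}
    (hu : ∀ y ∈ t, |u y| ≤ Real.tanh c ^ (S y).card) :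
    (fun σ => Real.exp (∑ e ∈ s, κ e * sgn (bond e.1 σ)) * ∏ y ∈ t, (1 + u y * obs (S y) σ)) ∈
      posType (V → ℤˣ) := by
  classical
  set U := t.biUnion S with hU
  have hUs : U ⊆ s := Finset.biUnion_subset.2 hS
  have h1 := exp_sum_mem_posType (s := s) (c := fun e => κ e - if e ∈ U then c else 0)
    (fun e he => by
      by_cases h : e ∈ U
      · obtain ⟨y, hy, hey⟩ := Finset.mem_biUnion.1 h
        simpa [h] using hcκ y hy e hey
      · simpa [h] using hκ e he) (fun e => bond e.1)
  have h2 : (fun σ => ∏ y ∈ t, (Real.exp (∑ e ∈ S y, c * sgn (bond e.1 σ)) *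
      (1 + u y * ∏ e ∈ S y, sgn (bond e.1 σ)))) ∈ posType (V → ℤˣ) :=
    prod_mem_posType fun y hy =>
      exp_sum_mul_one_add_mem_posType (S y) hc (hu y hy) (fun e => bond e.1)
  convert mul_mem_posType h1 h2 using 1
  ext σ
  rw [Finset.prod_mul_distrib, ← Real.exp_sum, ← Finset.sum_biUnion hd, ← mul_assoc,
    ← Real.exp_add]
  congr 2
  rw [← hU, ← Finset.inter_eq_right.2 hUs, ← Finset.filter_mem_eq_inter, Finset.sum_filter,
    ← Finset.sum_add_distrib]
  refine Finset.sum_congr rfl fun e he => ?_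
  by_cases h : e ∈ U <;> simp [h, he]
  ring

/-- Ginibre's condition for the Ising weights at two temperatures, stable under a small
perturbation by products of edge spins. -/
lemma isingWeight_mul_prod_mem_posType (hJ : ∀ e, 0 ≤ J e) (hh : ∀ x ∈ G, 0 ≤ h x)
    (hβ' : 0 ≤ β') (hβ : β' ≤ β) {T : Type*} {t : Finset T} {S : T → Finset (Edge V)}
    (hS : ∀ y ∈ t, S y ⊆ edgesIn G) (hd : (t : Set T).PairwiseDisjoint S) {c : ℝ} (hc : 0 < c)
    (hcκ : ∀ y ∈ t, ∀ e ∈ S y, c ≤ (β - β') * J e.1) {u : T → ℝ}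
    (hu : ∀ y ∈ t, |u y| ≤ Real.tanh c ^ (S y).card) (ρ : V → ℤˣ) :
    (fun σ => isingWeight J β h G σ * isingWeight J β' h G (σ * ρ) *
      ∏ y ∈ t, (1 + u y * obs (S y) σ)) ∈ posType (V → ℤˣ) := by
  -- The worst case is v = -1: the difference of inverse temperatures is the budget available for
  -- the perturbation.
  have hb : ∀ v : ℤˣ, β - β' ≤ β + β' * sgn v := fun v => by
    nlinarith [neg_one_le_sgn v]
  have hb0 : ∀ v : ℤˣ, 0 ≤ β + β' * sgn v := fun v => (sub_nonneg.2 hβ).trans (hb v)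
  have h1 := exp_sum_mul_prod_mem_posType (s := edgesIn G)
    (κ := fun e => (β + β' * sgn (bond e.1 ρ)) * J e.1) (fun e _ => mul_nonneg (hb0 _) (hJ _))
    hS hd hc (fun y hy e he => (hcκ y hy e he).trans
      (mul_le_mul_of_nonneg_right (hb _) (hJ _))) hu
  have h2 := exp_sum_mem_posType (s := G) (c := fun x => (β + β' * sgn (ρ x)) * h x)
    (fun x hx => mul_nonneg (hb0 _) (hh x hx)) (fun x => Pi.evalMonoidHom (fun _ : V => ℤˣ) x)
  convert mul_mem_posType h1 h2 using 1
  ext σ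
  rw [isingWeight_mul_isingWeight]
  ring

lemma isingWeight_mul_mem_posType (hJ : ∀ e, 0 ≤ J e) (hh : ∀ x ∈ G, 0 ≤ h x)
    (hβ : 0 ≤ β) (ρ : V → ℤˣ) :
    (fun σ => isingWeight J β h G σ * isingWeight J β h G (σ * ρ)) ∈ posType (V → ℤˣ) := by
  have := isingWeight_mul_prod_mem_posType (t := (∅ : Finset Unit)) (S := fun _ => ∅) hJ hh hβ
    le_rfl (by simp) (by simp) one_pos (by simp) (u := fun _ => 0) (by simp) ρ
  simpa using this

/-! ### Dependence on the volume -/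

/-- With free boundary conditions the correlations increase with the volume. -/
lemma isingMean_free_mono (hJ : ∀ e, 0 ≤ J e) (hβ : 0 ≤ β) (hG : G ⊆ G')
    {S : Finset (Edge V)} (hS : S ⊆ edgesIn G) :
    isingMean J β 0 G (obs S) ≤ isingMean J β 0 G' (obs S) := by
  have hW : ∀ z ∉ G, ∀ σ, isingWeight J β 0 G (Pi.mulSingle z (-1) * σ) = isingWeight J β 0 G σ := by
    intro z hz σ
    simp only [isingWeight, Pi.zero_apply, mul_zero, zero_mul, Finset.sum_const_zero, add_zero]
    congr 1
    refine Finset.sum_congr rfl fun e he => ?_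
    rw [map_mul, bond_mulSingle, if_neg fun h => hz (mem_edgesIn.1 he z h), one_mul]
  -- Neither the weight on G nor `obs S` sees the spins outside G, so both means can be taken over
  -- the configurations on G'.
  have h1 : isingMean J β 0 G (obs S) = mean (spinConfigs G') (isingWeight J β 0 G) (obs S) := by
    rw [isingMean, mean, mean, sum_spinConfigs_of_subset hG hW, sum_spinConfigs_of_subset hG
      (F := fun σ => obs S σ * isingWeight J β 0 G σ)
      fun z hz σ => by rw [obs_mulSingle_mul hS hz, hW z hz], mul_div_mul_left _ _ (by positivity)]
  rw [h1, obs_eq_fun]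
  refine mean_char_le_mean_char mul_mem_spinConfigs (sum_isingWeight_pos _)
    (sum_isingWeight_pos _) (fun ρ _ => ?_) _
  -- The duplicated weight has coupling βJ(1 ± 1) on the edges of G and βJ on the others.
  have key := exp_sum_mem_posType (s := edgesIn G')
    (c := fun e => β * J e.1 * (1 + if e ∈ edgesIn G then sgn (bond e.1 ρ) else 0))
    (fun e _ => mul_nonneg (mul_nonneg hβ (hJ _)) (by
      split_ifs
      · linarith [neg_one_le_sgn (bond e.1 ρ)]
      · norm_num)) (fun e => bond e.1)
  convert key using 1
  ext σ
  simp only [isingWeight, Pi.zero_apply, mul_zero, zero_mul, Finset.sum_const_zero, add_zero]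
  rw [← Real.exp_add, ← Finset.inter_eq_right.2 (edgesIn_mono hG), ← Finset.filter_mem_eq_inter,
    Finset.sum_filter, ← Finset.sum_add_distrib]
  congr 1
  refine Finset.sum_congr rfl fun e he => ?_
  by_cases h : e ∈ edgesIn G
  · simp only [h, he, map_mul, sgn_mul, Finset.mem_filter, and_self, if_true]
    ring
  · simp [h]

/-- Correlations decrease when a vertex with spin fixed to `1` is set free. -/
lemma isingMean_insert_le (hJ : ∀ e, 0 ≤ J e) (hβ : 0 ≤ β) {z : V} (hz : z ∉ G)
    {h h' : V → ℝ} (hh : ∀ x ∈ insert z G, 0 ≤ h' x) (hhh : ∀ x ∈ G, h x = h' x + J s(z, x))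
    (S : Finset (Edge V)) :
    isingMean J β h' (insert z G) (obs S) ≤ isingMean J β h G (obs S) := by
  -- When σ_z = 1, the edges from z to G act as the additional field J(z, x), and the field at z
  -- contributes only a constant.
  have hW : ∀ σ : V → ℤˣ, (1 + sgn (σ z)) / 2 * isingWeight J β h G σ =
      Real.exp (-(β * h' z)) * ((1 + sgn (σ z)) / 2 * isingWeight J β h' (insert z G) σ) := by
    intro σ
    rcases sgn_eq (σ z) with h1 | h1
    · rw [h1, isingWeight, isingWeight, Finset.sum_insert hz, mul_left_comm, ← Real.exp_add]
      have h2 := sum_edgesIn_insert hz fun e => β * J e * sgn (bond e σ)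
      rw [h2, h1]
      congr 2
      have h3 : ∑ x ∈ G, β * h x * sgn (σ x) =
          ∑ x ∈ G, β * J s(z, x) * sgn (bond s(z, x) σ) + ∑ x ∈ G, β * h' x * sgn (σ x) := by
        rw [← Finset.sum_add_distrib]
        refine Finset.sum_congr rfl fun x hx => ?_
        rw [hhh x hx, bond_mk, sgn_mul, h1]
        ring
      rw [h3]
      ring
    · rw [h1]; simp
  have h1 : isingMean J β h G (obs S) = mean (spinConfigs (insert z G))
      (fun σ => (1 + sgn (σ z)) / 2 * isingWeight J β h' (insert z G) σ) (obs S) := by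
    rw [isingMean, mean, mean, sum_spinConfigs_eq_sum_insert hz, sum_spinConfigs_eq_sum_insert hz]
    simp_rw [mul_left_comm ((1 + sgn _) / 2) (obs S _) _, hW]
    rw [← Finset.mul_sum]
    simp_rw [mul_left_comm (obs S _) (Real.exp _) _]
    rw [← Finset.mul_sum, mul_div_mul_left _ _ (Real.exp_pos _).ne']
  rw [h1, obs_eq_fun]
  refine mean_char_le_mean_char mul_mem_spinConfigs ?_ (sum_isingWeight_pos _) (fun ρ _ => ?_) _
  · refine Finset.sum_pos' (fun σ _ => mul_nonneg ?_ (isingWeight_pos σ).le)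
      ⟨1, one_mem_spinConfigs _, mul_pos ?_ (isingWeight_pos _)⟩
    · linarith [neg_one_le_sgn (σ z)]
    · simp
  · have h2 : (fun σ : V → ℤˣ => (1 + sgn (Pi.evalMonoidHom (fun _ : V => ℤˣ) z σ)) / 2) ∈
        posType (V → ℤˣ) := by
      simp_rw [div_eq_inv_mul]
      exact const_mul_mem_posType (by norm_num)
        (add_mem_posType (const_mem_posType zero_le_one) (char_mem_posType _))
    convert mul_mem_posType h2 (isingWeight_mul_mem_posType hJ hh hβ ρ) using 1
    ext σ
    simp only [Pi.evalMonoidHom_apply]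
    ring

/-! ### Tilted means -/

/-- Lowering the temperature raises the correlations, even after a small perturbation of the
weight at the lower temperature. -/
lemma isingMean_le_mean_tilt (hJ : ∀ e, 0 ≤ J e) (hh : ∀ x ∈ G, 0 ≤ h x)
    (hβ' : 0 ≤ β') (hβ : β' ≤ β) {T : Type*} {t : Finset T} {S : T → Finset (Edge V)}
    (hS : ∀ y ∈ t, S y ⊆ edgesIn G) (hd : (t : Set T).PairwiseDisjoint S) {c : ℝ} (hc : 0 < c)
    (hcκ : ∀ y ∈ t, ∀ e ∈ S y, c ≤ (β - β') * J e.1) {a : ℝ} (ha0 : |a| < 1)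
    (ha : ∀ y ∈ t, |a| ≤ Real.tanh c ^ (S y).card) (R : Finset (Edge V)) :
    isingMean J β' h G (obs R) ≤ mean (spinConfigs G)
      (fun σ => (∏ y ∈ t, (1 + a * obs (S y) σ)) * isingWeight J β h G σ) (obs R) := by
  have hpos : ∀ σ, 0 < ∏ y ∈ t, (1 + a * obs (S y) σ) := fun σ => Finset.prod_pos fun y _ => by
    have : |a * obs (S y) σ| < 1 := by rwa [abs_mul, abs_obs, mul_one]
    linarith [(abs_lt.1 this).1]
  rw [obs_eq_fun]
  refine mean_char_le_mean_char mul_mem_spinConfigs ?_ (sum_isingWeight_pos _) (fun ρ _ => ?_) _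
  · exact Finset.sum_pos (fun σ _ => mul_pos (hpos σ) (isingWeight_pos σ))
      ⟨1, one_mem_spinConfigs G⟩
  · convert isingWeight_mul_prod_mem_posType hJ hh hβ' hβ hS hd hc hcκ (u := fun _ => a) ha ρ using 1
    ext σ
    ring

/-- Raising the temperature lowers the correlations, even after a small perturbation of the
weight at the higher temperature. -/
lemma mean_tilt_le_isingMean (hJ : ∀ e, 0 ≤ J e) (hh : ∀ x ∈ G, 0 ≤ h x)
    (hβ' : 0 ≤ β') (hβ : β' ≤ β) {T : Type*} {t : Finset T} {S : T → Finset (Edge V)}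
    (hS : ∀ y ∈ t, S y ⊆ edgesIn G) (hd : (t : Set T).PairwiseDisjoint S) {c : ℝ} (hc : 0 < c)
    (hcκ : ∀ y ∈ t, ∀ e ∈ S y, c ≤ (β - β') * J e.1) {a : ℝ} (ha0 : |a| < 1)
    (ha : ∀ y ∈ t, |a| ≤ Real.tanh c ^ (S y).card) (R : Finset (Edge V)) :
    mean (spinConfigs G)
      (fun σ => (∏ y ∈ t, (1 + a * obs (S y) σ)) * isingWeight J β' h G σ) (obs R) ≤
      isingMean J β h G (obs R) := by
  have hpos : ∀ σ, 0 < ∏ y ∈ t, (1 + a * obs (S y) σ) := fun σ => Finset.prod_pos fun y _ => by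
    have : |a * obs (S y) σ| < 1 := by rwa [abs_mul, abs_obs, mul_one]
    linarith [(abs_lt.1 this).1]
  rw [obs_eq_fun]
  refine mean_char_le_mean_char mul_mem_spinConfigs (sum_isingWeight_pos _) ?_ (fun ρ _ => ?_) _
  · exact Finset.sum_pos (fun σ _ => mul_pos (hpos σ) (isingWeight_pos σ))
      ⟨1, one_mem_spinConfigs G⟩
  -- Here the tilt sits on the copy σρ, so its coefficients acquire the sign `obs (S y) ρ`. This is
  -- why the perturbation must be allowed either sign, depending on y.
  · convert isingWeight_mul_prod_mem_posType hJ hh hβ' hβ hS hd hc hcκ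
      (u := fun y => a * obs (S y) ρ) (fun y hy => by simpa [abs_mul, abs_obs] using ha y hy) ρ using 1
    ext σ
    have : ∏ y ∈ t, (1 + a * obs (S y) (σ * ρ)) = ∏ y ∈ t, (1 + a * obs (S y) ρ * obs (S y) σ) :=
      Finset.prod_congr rfl fun y _ => by rw [obs_mul]; ring
    rw [this]
    ring

end Ising

/-! ### Translations -/

section Translation

variable {d : ℕ}

/-- The translate by `x` of a finite set of vertices. -/
def shiftSites (x : Site d) (G : Finset (Site d)) : Finset (Site d) :=
  G.map (Equiv.addRight x).toEmbedding

/-- The translate by `x` of a finite set of edges. -/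
def shiftEdges (x : Site d) (S : Finset (Edge (Site d))) : Finset (Edge (Site d)) :=
  S.map ⟨Edge.map (Equiv.addRight x).toEmbedding, Edge.map_injective _⟩

lemma mem_shiftSites {x y : Site d} {G : Finset (Site d)} : y ∈ shiftSites x G ↔ y - x ∈ G := by
  simp only [shiftSites, Finset.mem_map, Equiv.coe_toEmbedding, Equiv.coe_addRight]
  exact ⟨fun ⟨a, ha, h⟩ => by rwa [← h, add_sub_cancel_right], fun h => ⟨_, h, sub_add_cancel _ _⟩⟩

lemma shiftEdges_edgesIn (x : Site d) (G : Finset (Site d)) :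
    shiftEdges x (edgesIn G) = edgesIn (shiftSites x G) := by
  ext e
  simp only [shiftEdges, Finset.mem_map, Function.Embedding.coeFn_mk, mem_edgesIn]
  constructor
  · rintro ⟨e, he, rfl⟩ y hy
    obtain ⟨z, hz, rfl⟩ := Sym2.mem_map.1 hy
    exact mem_shiftSites.2 (by simpa using he z hz)
  · intro h
    refine ⟨e.map (Equiv.addRight (-x)).toEmbedding, ?_, ?_⟩
    · intro y hy
      obtain ⟨z, hz, rfl⟩ := Sym2.mem_map.1 hy
      simpa [sub_eq_add_neg] using mem_shiftSites.1 (h z hz)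
    · apply Subtype.ext
      have : (Equiv.addRight x).toEmbedding ∘ (Equiv.addRight (-x)).toEmbedding = id := by
        funext z
        simp
      change Sym2.map _ (Sym2.map _ e.1) = e.1
      rw [Sym2.map_map, this, Sym2.map_id, id]

lemma obs_shiftEdges (x : Site d) (S : Finset (Edge (Site d))) (σ : Site d → ℤˣ) :
    obs (shiftEdges x S) σ = obs S (σ ∘ (· + x)) := by
  simp only [obs, shiftEdges, Finset.prod_map, Function.Embedding.coeFn_mk, Edge.map]
  refine Finset.prod_congr rfl fun e _ => ?_
  rw [bond_map]
  rfl

variable {J : Sym2 (Site d) → ℝ}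

lemma IsCoupling.map_add (hJ : IsCoupling J) (x : Site d) (e : Sym2 (Site d)) :
    J (e.map (· + x)) = J e := by
  induction e using Sym2.ind with
  | _ a b => rw [Sym2.map_mk, hJ.translation, hJ.translation a b, add_sub_add_right_eq_sub]

lemma IsCoupling.nonneg' (hJ : IsCoupling J) (e : Sym2 (Site d)) : 0 ≤ J e := by
  induction e using Sym2.ind with
  | _ a b => exact hJ.nonneg a b

lemma IsCoupling.summable_right (hJ : IsCoupling J) (x : Site d) :
    Summable fun y => J s(x, y) := by
  simp_rw [fun y => hJ.translation x y]
  exact (Equiv.subRight x).summable_iff.2 hJ.summable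

lemma ghostCoupling_eq (hJ : IsCoupling J) (G : Finset (Site d)) (x : Site d) :
    ghostCoupling J G x = ∑' y, J s(x, y) - ∑ y ∈ G, J s(x, y) := by
  rw [← (hJ.summable_right x).sum_add_tsum_subtype_compl G, add_sub_cancel_left]
  rfl

lemma ghostCoupling_nonneg (hJ : IsCoupling J) (G : Finset (Site d)) (x : Site d) :
    0 ≤ ghostCoupling J G x := tsum_nonneg fun y => hJ.nonneg x y

lemma ghostCoupling_insert (hJ : IsCoupling J) {G : Finset (Site d)} {z : Site d} (hz : z ∉ G)
    (x : Site d) : ghostCoupling J G x = ghostCoupling J (insert z G) x + J s(z, x) := by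
  rw [ghostCoupling_eq hJ, ghostCoupling_eq hJ, Finset.sum_insert hz, Sym2.eq_swap]
  ring

lemma ghostCoupling_shift (hJ : IsCoupling J) (G : Finset (Site d)) (x y : Site d) :
    ghostCoupling J (shiftSites x G) (y + x) = ghostCoupling J G y := by
  have h : ∀ z, J s(y + x, z + x) = J s(y, z) := fun z => by
    simpa using hJ.map_add x s(y, z)
  rw [ghostCoupling_eq hJ, ghostCoupling_eq hJ, ← (Equiv.addRight x).tsum_eq]
  simp [shiftSites, h]

lemma isingMean_shift (hJ : IsCoupling J) (β : ℝ) (h : Site d → ℝ) (G : Finset (Site d))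
    (x : Site d) (S : Finset (Edge (Site d))) :
    isingMean J β h (shiftSites x G) (obs (shiftEdges x S)) =
      isingMean J β (fun y => h (y + x)) G (obs S) := by
  have hW : ∀ σ : Site d → ℤˣ, isingWeight J β h (shiftSites x G) σ =
      isingWeight J β (fun y => h (y + x)) G (σ ∘ (· + x)) := by
    intro σ
    rw [isingWeight, isingWeight, ← shiftEdges_edgesIn, shiftEdges, shiftSites, Finset.sum_map,
      Finset.sum_map]
    simp only [Function.Embedding.coeFn_mk, Edge.map, Equiv.coe_addRight, bond_map, hJ.map_add]
    rfl
  have hsum : ∀ F : (Site d → ℤˣ) → ℝ, ∑ σ ∈ spinConfigs (shiftSites x G), F (σ ∘ (· + x)) =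
      ∑ σ ∈ spinConfigs G, F σ := by
    intro F
    refine Finset.sum_nbij' (fun σ => σ ∘ (· + x)) (fun σ => σ ∘ (· - x)) ?_ ?_ ?_ ?_
      (fun _ _ => rfl)
    · intro σ hσ
      rw [mem_spinConfigs] at hσ ⊢
      exact fun y hy => hσ _ (by simpa [mem_shiftSites] using hy)
    · intro σ hσ
      rw [mem_spinConfigs] at hσ ⊢
      exact fun y hy => hσ _ (by simpa [mem_shiftSites] using hy)
    · intro σ _; ext; simp
    · intro σ _; ext; simp
  rw [isingMean, isingMean, mean, mean, ← hsum, ← hsum]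
  simp_rw [hW, obs_shiftEdges]

/-! ### Limits along finite sets and along boxes -/

lemma exists_subset_edgesIn (S : Finset (Edge (Site d))) : ∃ G : Finset (Site d), S ⊆ edgesIn G :=
  ⟨S.biUnion fun e => e.1.toFinset, fun e he => mem_edgesIn.2 fun _ hx =>
    Finset.mem_biUnion.2 ⟨e, he, Sym2.mem_toFinset.2 hx⟩⟩

lemma box_mono (d : ℕ) : Monotone (box d) := by
  intro L L' h
  apply Finset.Icc_subset_Icc <;> intro i <;> simpa using h

lemma exists_mem_box (x : Site d) : ∃ L, x ∈ box d L := by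
  refine ⟨∑ i, (x i).natAbs, ?_⟩
  have h : ∀ i, |x i| ≤ ((∑ i, (x i).natAbs : ℕ) : ℤ) := fun i => by
    rw [Int.abs_eq_natAbs]
    exact_mod_cast Finset.single_le_sum (f := fun i => (x i).natAbs) (fun _ _ => Nat.zero_le _)
      (Finset.mem_univ i)
  rw [box, Finset.mem_Icc]
  exact ⟨fun i => (abs_le.1 (h i)).1, fun i => (abs_le.1 (h i)).2⟩

lemma tendsto_box (d : ℕ) : Tendsto (box d) atTop atTop :=
  tendsto_atTop_finset_of_monotone (box_mono d) exists_mem_box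

lemma tendsto_shiftSites (x : Site d) : Tendsto (shiftSites x) atTop atTop := by
  refine tendsto_atTop_atTop.2 fun G => ⟨shiftSites (-x) G, fun G' h y hy => ?_⟩
  exact mem_shiftSites.2 (h (mem_shiftSites.2 (by simpa using hy)))

lemma eventually_subset_edgesIn (S : Finset (Edge (Site d))) :
    ∀ᶠ G : Finset (Site d) in atTop, S ⊆ edgesIn G := by
  obtain ⟨G₀, h⟩ := exists_subset_edgesIn S
  filter_upwards [eventually_ge_atTop G₀] with G hG using h.trans (edgesIn_mono hG)

/-- The limit is a supremum over volumes; this bound is kept because it supplies semicontinuity in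
β. Taking the union with a set that contains `S` makes the function monotone on all finite sets. -/
lemma exists_tendsto_free (hJ : IsCoupling J) {β : ℝ} (hβ : 0 ≤ β) (S : Finset (Edge (Site d))) :
    ∃ m, Tendsto (fun G => isingMean J β 0 G (obs S)) atTop (𝓝 m) ∧
      ∀ G, S ⊆ edgesIn G → isingMean J β 0 G (obs S) ≤ m := by
  obtain ⟨G₀, h₀⟩ := exists_subset_edgesIn S
  have hm : Monotone fun G => isingMean J β 0 (G ∪ G₀) (obs S) := fun G G' h =>
    isingMean_free_mono hJ.nonneg' hβ (Finset.union_subset_union_left h)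
      (h₀.trans (edgesIn_mono Finset.subset_union_right))
  have hb : BddAbove (Set.range fun G => isingMean J β 0 (G ∪ G₀) (obs S)) := by
    refine ⟨1, ?_⟩
    rintro _ ⟨G, rfl⟩
    exact (abs_le.1 (abs_isingMean_le fun σ => (abs_obs S σ).le)).2
  refine ⟨_, (tendsto_atTop_ciSup hm hb).congr' ?_, fun G hG => ?_⟩
  · filter_upwards [eventually_ge_atTop G₀] with G hG
    rw [Finset.union_eq_left.2 hG]
  · exact (isingMean_free_mono hJ.nonneg' hβ Finset.subset_union_left hG).trans (le_ciSup hb G)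

/-- The limit is an infimum. Spins outside the volume equal 1, so the bound holds even in volumes
that do not contain `S`. -/
lemma exists_tendsto_plus (hJ : IsCoupling J) {β : ℝ} (hβ : 0 ≤ β) (S : Finset (Edge (Site d))) :
    ∃ m, Tendsto (fun G => isingMean J β (ghostCoupling J G) G (obs S)) atTop (𝓝 m) ∧
      ∀ G, m ≤ isingMean J β (ghostCoupling J G) G (obs S) := by
  have hm : Antitone fun G => isingMean J β (ghostCoupling J G) G (obs S) :=
    Finset.antitone_iff_forall_insert_le.2 fun G z hz =>
      isingMean_insert_le hJ.nonneg' hβ hz (fun x _ => ghostCoupling_nonneg hJ _ x)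
        (fun x _ => ghostCoupling_insert hJ hz x) S
  have hb : BddBelow (Set.range fun G => isingMean J β (ghostCoupling J G) G (obs S)) := by
    refine ⟨-1, ?_⟩
    rintro _ ⟨G, rfl⟩
    exact (abs_le.1 (abs_isingMean_le fun σ => (abs_obs S σ).le)).1
  exact ⟨_, tendsto_atTop_ciInf hm hb, fun G => ciInf_le hb G⟩

lemma shiftSites_shiftSites_neg (x : Site d) (G : Finset (Site d)) :
    shiftSites x (shiftSites (-x) G) = G := by
  ext y
  simp [mem_shiftSites]

/-- Translating the observable amounts to translating the box backwards, and the limit is along all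
finite sets. This is the source of translation invariance. -/
lemma tendsto_box_shift_free (hJ : IsCoupling J) {β m : ℝ} {S : Finset (Edge (Site d))}
    (h : Tendsto (fun G => isingMean J β 0 G (obs S)) atTop (𝓝 m)) (x : Site d) :
    Tendsto (fun L => isingMean J β 0 (box d L) (obs (shiftEdges x S))) atTop (𝓝 m) := by
  have := h.comp ((tendsto_shiftSites (-x)).comp (tendsto_box d))
  refine this.congr fun L => ?_
  simp only [Function.comp_apply]
  conv_rhs => rw [← shiftSites_shiftSites_neg x (box d L), isingMean_shift hJ]
  rfl

lemma tendsto_box_shift_plus (hJ : IsCoupling J) {β m : ℝ} {S : Finset (Edge (Site d))}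
    (h : Tendsto (fun G => isingMean J β (ghostCoupling J G) G (obs S)) atTop (𝓝 m)) (x : Site d) :
    Tendsto (fun L => isingMean J β (ghostCoupling J (box d L)) (box d L) (obs (shiftEdges x S)))
      atTop (𝓝 m) := by
  have := h.comp ((tendsto_shiftSites (-x)).comp (tendsto_box d))
  refine this.congr fun L => ?_
  simp only [Function.comp_apply]
  conv_rhs => rw [← shiftSites_shiftSites_neg x (box d L), isingMean_shift hJ]
  simp_rw [ghostCoupling_shift hJ]

/-! ### Exponential moments -/

lemma exists_pos_le_coupling {S : Finset (Edge (Site d))} (hS : ∀ e ∈ S, 0 < J e.1) :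
    ∃ j, 0 < j ∧ ∀ e ∈ S, j ≤ J e.1 := by
  rcases S.eq_empty_or_nonempty with rfl | hne
  · exact ⟨1, one_pos, by simp⟩
  · obtain ⟨e, he, h⟩ := S.exists_min_image (fun e => J e.1) hne
    exact ⟨J e.1, hS e he, h⟩

lemma card_shiftEdges (x : Site d) (S : Finset (Edge (Site d))) :
    (shiftEdges x S).card = S.card := Finset.card_map _

lemma IsCoupling.le_of_mem_shiftEdges (hJ : IsCoupling J) {j : ℝ} {S : Finset (Edge (Site d))}
    (hj : ∀ e ∈ S, j ≤ J e.1) (x : Site d) : ∀ e ∈ shiftEdges x S, j ≤ J e.1 := by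
  intro e he
  obtain ⟨e, h, rfl⟩ := Finset.mem_map.1 he
  exact (hj e h).trans (hJ.map_add x e.1).ge

lemma IsCoupling.tilt_bound (hJ : IsCoupling J) {δ j : ℝ} (hδ : 0 ≤ δ)
    {S : Finset (Edge (Site d))} (hj : ∀ e ∈ S, j ≤ J e.1) (T : Finset (Site d)) :
    ∀ y ∈ T, ∀ e ∈ shiftEdges y S, δ * j ≤ δ * J e.1 :=
  fun y _ e he => mul_le_mul_of_nonneg_left (hJ.le_of_mem_shiftEdges hj y e he) hδ

lemma tanh_pow_pos {c : ℝ} (hc : 0 < c) (n : ℕ) : 0 < Real.tanh c ^ n := by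
  rw [Real.tanh_eq_sinh_div_cosh]
  exact pow_pos (div_pos (Real.sinh_pos_iff.2 hc) (Real.cosh_pos c)) n

/-- The state with means `isingMean J β (h L) (box d L)` has correlations `Φ` in the limit, and
satisfies a one-sided exponential bound for sums of distant products of edge spins. -/
structure IsSpinLimit (J : Sym2 (Site d) → ℝ) (β : ℝ) (h : ℕ → Site d → ℝ)
    (Φ : Finset (Edge (Site d)) → ℝ) : Prop where
  tendsto : ∀ S x, Tendsto (fun L => isingMean J β (h L) (box d L) (obs (shiftEdges x S))) atTop
    (𝓝 (Φ S))
  tilt : ∀ S : Finset (Edge (Site d)), (∀ e ∈ S, 0 < J e.1) → ∃ s : ℝ, |s| = 1 ∧ ∀ η > 0,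
    ∃ a₀ > 0, ∀ a, 0 < a → a ≤ a₀ → ∀ T : Finset (Site d),
      (T : Set (Site d)).PairwiseDisjoint (fun y => shiftEdges y S) →
      ∀ᶠ L in atTop, isingMean J β (h L) (box d L)
        (fun σ => ∏ y ∈ T, (1 + a * (s * obs (shiftEdges y S) σ))) ≤ (1 + a * (s * Φ S + η)) ^ T.card

/-- By the chain rule each new factor contributes 1 + b times a correlation in the state tilted by
the earlier factors, so a bound uniform over the tilts suffices. -/
lemma isingMean_prod_le {V : Type} [DecidableEq V] {J : Sym2 V → ℝ} {β : ℝ} {h : V → ℝ}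
    {G : Finset V} {ι : Type*} {t : Finset ι} {S : ι → Finset (Edge V)} {b m : ℝ} (hb : |b| < 1)
    (hm : 0 ≤ 1 + m)
    (H : ∀ t' ⊆ t, ∀ x ∈ t, b * mean (spinConfigs G)
      (fun σ => (∏ y ∈ t', (1 + b * obs (S y) σ)) * isingWeight J β h G σ) (obs (S x)) ≤ m) :
    isingMean J β h G (fun σ => ∏ y ∈ t, (1 + b * obs (S y) σ)) ≤ (1 + m) ^ t.card := by
  classical
  have hpos : ∀ (t' : Finset ι) σ, 0 < ∏ y ∈ t', (1 + b * obs (S y) σ) := fun t' σ =>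
    Finset.prod_pos fun y _ => by
      have : |b * obs (S y) σ| < 1 := by rwa [abs_mul, abs_obs, mul_one]
      linarith [(abs_lt.1 this).1]
  have key : ∀ t' ⊆ t,
      isingMean J β h G (fun σ => ∏ y ∈ t', (1 + b * obs (S y) σ)) ≤ (1 + m) ^ t'.card := by
    intro t'
    induction t' using Finset.induction_on with
    | empty => intro _; simpa using (isingMean_const (J := J) (β := β) (h := h) (G := G) 1).le
    | insert x t' hx ih =>
      intro ht
      rw [Finset.insert_subset_iff] at ht
      have hZ : 0 < ∑ σ ∈ spinConfigs G,
          (∏ y ∈ t', (1 + b * obs (S y) σ)) * isingWeight J β h G σ :=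
        Finset.sum_pos (fun σ _ => mul_pos (hpos t' σ) (isingWeight_pos σ))
          ⟨1, one_mem_spinConfigs G⟩
      have h1 : isingMean J β h G (fun σ => ∏ y ∈ insert x t', (1 + b * obs (S y) σ)) =
          isingMean J β h G (fun σ => ∏ y ∈ t', (1 + b * obs (S y) σ)) *
            (1 + b * mean (spinConfigs G)
              (fun σ => (∏ y ∈ t', (1 + b * obs (S y) σ)) * isingWeight J β h G σ) (obs (S x))) := by
        simp_rw [Finset.prod_insert hx, mul_comm (1 + b * obs (S x) _)]
        rw [isingMean, mean_mul_right _ _ _ _ hZ.ne', mean_add, mean_const hZ, mean_const_mul]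
        rfl
      rw [h1, Finset.card_insert_of_notMem hx, pow_succ]
      have h0 : 0 ≤ isingMean J β h G (fun σ => ∏ y ∈ t', (1 + b * obs (S y) σ)) := by
        rw [← isingMean_const (J := J) (β := β) (h := h) (G := G) 0]
        exact isingMean_mono fun σ => (hpos t' σ).le
      exact mul_le_mul (ih ht.2) (by linarith [H t' ht.2 x ht.1]) (by
        have : |mean (spinConfigs G)
          (fun σ => (∏ y ∈ t', (1 + b * obs (S y) σ)) * isingWeight J β h G σ) (obs (S x))| ≤ 1 := by
          have hw : ∀ σ ∈ spinConfigs G,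
              0 ≤ (∏ y ∈ t', (1 + b * obs (S y) σ)) * isingWeight J β h G σ :=
            fun σ _ => (mul_pos (hpos t' σ) (isingWeight_pos σ)).le
          rw [abs_le]
          constructor
          · rw [← mean_const hZ (-1)]
            exact mean_mono hw fun σ _ => (abs_le.1 (abs_obs (S x) σ).le).1
          · exact (mean_mono hw fun σ _ => (abs_le.1 (abs_obs (S x) σ).le).2).trans
              (mean_const hZ 1).le
        have h2 : |b * mean (spinConfigs G)
          (fun σ => (∏ y ∈ t', (1 + b * obs (S y) σ)) * isingWeight J β h G σ) (obs (S x))| ≤ 1 := by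
          rw [abs_mul]
          exact mul_le_one₀ hb.le (abs_nonneg _) this
        linarith [(abs_le.1 h2).1]) (pow_nonneg hm _)
  exact key t subset_rfl

lemma eventually_box_subset_edgesIn (S : Finset (Edge (Site d))) (T : Finset (Site d)) :
    ∀ᶠ L in atTop, ∀ y ∈ T, shiftEdges y S ⊆ edgesIn (box d L) :=
  (eventually_all_finset T).2 fun y _ =>
    (tendsto_box d).eventually (eventually_subset_edgesIn (shiftEdges y S))

/-- The Ising states with free boundary conditions. -/
theorem exists_isSpinLimit_free (hJ : IsCoupling J) {β : ℝ} (hβ : 0 < β) :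
    ∃ Φ, IsSpinLimit J β (fun _ => 0) Φ := by
  choose! Φ hΦ hle using fun (β : ℝ) (hβ : 0 ≤ β) (S : Finset (Edge (Site d))) =>
    exists_tendsto_free hJ hβ S
  refine ⟨Φ β, fun S x => tendsto_box_shift_free hJ (hΦ β hβ.le S) x, fun S hS => ?_⟩
  -- Comparison with a smaller β' bounds tilted correlations from below, hence the sign -1.
  refine ⟨-1, by simp, fun η hη => ?_⟩
  -- Left continuity of the free correlation: choose a finite volume almost attaining the supremum,
  -- lower β by continuity there, and return to infinite volume by the supremum bound.
  obtain ⟨β', hβ', hββ', hΦβ'⟩ : ∃ β', 0 < β' ∧ β' < β ∧ Φ β S - η / 2 < Φ β' S := by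
    obtain ⟨G, hG, hSG⟩ := (((hΦ β hβ.le S).eventually (lt_mem_nhds
      (show Φ β S - η / 2 < Φ β S by linarith))).and (eventually_subset_edgesIn S)).exists
    have h1 : ∀ᶠ β' in 𝓝[<] β, Φ β S - η / 2 < isingMean J β' 0 G (obs S) :=
      ((continuous_isingMean (obs S)).tendsto β |>.mono_left nhdsWithin_le_nhds).eventually
        (lt_mem_nhds hG)
    obtain ⟨β', h2, h3⟩ := (h1.and (Ioo_mem_nhdsLT hβ)).exists
    exact ⟨β', h3.1, h3.2, h2.trans_le (hle β' h3.1.le S G hSG)⟩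
  obtain ⟨j, hj0, hj⟩ := exists_pos_le_coupling hS
  have hc : 0 < (β - β') * j := mul_pos (sub_pos.2 hββ') hj0
  -- The bound 1/2 keeps the tilting factors positive; the other is what Ginibre's condition
  -- tolerates when every edge of `S` has coupling at least j.
  refine ⟨min (1 / 2) (Real.tanh ((β - β') * j) ^ S.card), lt_min (by norm_num)
    (tanh_pow_pos hc _), fun a ha0 ha T hT => ?_⟩
  have hlim : ∀ᶠ L in atTop, ∀ x ∈ T,
      Φ β' S - η / 2 < isingMean J β' 0 (box d L) (obs (shiftEdges x S)) :=
    (eventually_all_finset T).2 fun x _ => (tendsto_box_shift_free hJ (hΦ β' hβ'.le S) x).eventually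
      (lt_mem_nhds (by linarith))
  filter_upwards [hlim, eventually_box_subset_edgesIn S T] with L hL hLS
  have ha1 : |-a| < 1 := by
    rw [abs_neg, abs_of_pos ha0]
    linarith [ha.trans (min_le_left _ _)]
  have hΦ1 : Φ β S ≤ 1 := le_of_tendsto (hΦ β hβ.le S)
    (Eventually.of_forall fun G => (abs_le.1 (abs_isingMean_le fun σ => (abs_obs S σ).le)).2)
  have hrw : ∀ σ : Site d → ℤˣ, ∏ y ∈ T, (1 + a * (-1 * obs (shiftEdges y S) σ)) =
      ∏ y ∈ T, (1 + -a * obs (shiftEdges y S) σ) :=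
    fun σ => Finset.prod_congr rfl fun y _ => by ring
  simp_rw [hrw]
  refine isingMean_prod_le ha1 ?_ fun t ht x hx => ?_
  · nlinarith [(abs_lt.1 ha1).1]
  · have h1 := isingMean_le_mean_tilt (h := 0) (R := shiftEdges x S) (a := -a) hJ.nonneg'
      (fun _ _ => le_rfl) hβ'.le
      hββ'.le (fun y hy => hLS y (ht hy)) (hT.subset (Finset.coe_subset.2 ht)) hc
      (hJ.tilt_bound (sub_pos.2 hββ').le hj t) ha1 fun y _ => by
        rw [card_shiftEdges, abs_neg, abs_of_pos ha0]
        exact ha.trans (min_le_right _ _)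
    have h2 := hL x hx
    rw [neg_mul, ← mul_neg]
    exact mul_le_mul_of_nonneg_left (by linarith) ha0.le

/-- The Ising states with plus boundary conditions. -/
theorem exists_isSpinLimit_plus (hJ : IsCoupling J) {β : ℝ} (hβ : 0 < β) :
    ∃ Φ, IsSpinLimit J β (fun L => ghostCoupling J (box d L)) Φ := by
  choose! Φ hΦ hle using fun (β : ℝ) (hβ : 0 ≤ β) (S : Finset (Edge (Site d))) =>
    exists_tendsto_plus hJ hβ S
  refine ⟨Φ β, fun S x => tendsto_box_shift_plus hJ (hΦ β hβ.le S) x, fun S hS => ?_⟩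
  refine ⟨1, by simp, fun η hη => ?_⟩
  -- Mirror image of the free case: an infimum of continuous functions of β gives right continuity,
  -- and the larger β' bounds tilted correlations from above.
  obtain ⟨β', hββ', hΦβ'⟩ : ∃ β', β < β' ∧ Φ β' S < Φ β S + η / 2 := by
    obtain ⟨G, hG⟩ := ((hΦ β hβ.le S).eventually (gt_mem_nhds
      (show Φ β S < Φ β S + η / 2 by linarith))).exists
    have h1 : ∀ᶠ β' in 𝓝[>] β, isingMean J β' (ghostCoupling J G) G (obs S) < Φ β S + η / 2 :=
      ((continuous_isingMean (obs S)).tendsto β |>.mono_left nhdsWithin_le_nhds).eventually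
        (gt_mem_nhds hG)
    obtain ⟨β', h2, h3⟩ := (h1.and self_mem_nhdsWithin).exists
    exact ⟨β', h3, (hle β' (hβ.trans h3).le S G).trans_lt h2⟩
  have hβ' : 0 < β' := hβ.trans hββ'
  obtain ⟨j, hj0, hj⟩ := exists_pos_le_coupling hS
  have hc : 0 < (β' - β) * j := mul_pos (sub_pos.2 hββ') hj0
  refine ⟨min (1 / 2) (Real.tanh ((β' - β) * j) ^ S.card), lt_min (by norm_num)
    (tanh_pow_pos hc _), fun a ha0 ha T hT => ?_⟩
  have hlim : ∀ᶠ L in atTop, ∀ x ∈ T,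
      isingMean J β' (ghostCoupling J (box d L)) (box d L) (obs (shiftEdges x S)) <
        Φ β' S + η / 2 :=
    (eventually_all_finset T).2 fun x _ => (tendsto_box_shift_plus hJ (hΦ β' hβ'.le S) x).eventually
      (gt_mem_nhds (by linarith))
  filter_upwards [hlim, eventually_box_subset_edgesIn S T] with L hL hLS
  have ha1 : |a| < 1 := by
    rw [abs_of_pos ha0]
    linarith [ha.trans (min_le_left _ _)]
  have hΦ1 : -1 ≤ Φ β S := ge_of_tendsto (hΦ β hβ.le S)
    (Eventually.of_forall fun G => (abs_le.1 (abs_isingMean_le fun σ => (abs_obs S σ).le)).1)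
  simp_rw [one_mul]
  refine isingMean_prod_le ha1 ?_ fun t ht x hx => ?_
  · nlinarith [(abs_lt.1 ha1).2]
  · have h1 := mean_tilt_le_isingMean (h := ghostCoupling J (box d L)) (R := shiftEdges x S)
      (a := a) hJ.nonneg' (fun _ _ => ghostCoupling_nonneg hJ _ _) hβ.le
      hββ'.le (fun y hy => hLS y (ht hy)) (hT.subset (Finset.coe_subset.2 ht)) hc
      (hJ.tilt_bound (sub_pos.2 hββ').le hj t) ha1 fun y _ => by
        rw [card_shiftEdges, abs_of_pos ha0]
        exact ha.trans (min_le_right _ _)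
    have h2 := hL x hx
    exact mul_le_mul_of_nonneg_left (by linarith) ha0.le

end Translation

/-! ### Sums over currents -/

section Sums

lemma summable_norm_and_hasSum_fin_prod {N : ℕ} (t : Fin N → ℕ → ℝ)
    (ht : ∀ i, Summable fun k => ‖t i k‖) :
    (Summable fun n : Fin N → ℕ => ‖∏ i, t i (n i)‖) ∧
      HasSum (fun n : Fin N → ℕ => ∏ i, t i (n i)) (∏ i, ∑' k, t i k) := by
  induction N with
  | zero =>
    constructor
    · exact Summable.of_finite
    · simp
  | succ N ih =>
    obtain ⟨h1, h2⟩ := ih (fun i => t i.succ) fun i => ht i.succ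
    have h3 := (ht 0).mul_norm h1
    have hE : (fun n : Fin (N + 1) → ℕ => ∏ i, t i (n i)) ∘ Fin.consEquiv (fun _ => ℕ) =
        fun p : ℕ × (Fin N → ℕ) => t 0 p.1 * ∏ i, t i.succ (p.2 i) :=
      funext fun p => by simp [Fin.prod_univ_succ, Fin.consEquiv]
    constructor
    · rw [← (Fin.consEquiv (fun _ => ℕ)).summable_iff]
      have h4 : (fun n : Fin (N + 1) → ℕ => ‖∏ i, t i (n i)‖) ∘ Fin.consEquiv (fun _ => ℕ) =
          fun p : ℕ × (Fin N → ℕ) => ‖t 0 p.1 * ∏ i, t i.succ (p.2 i)‖ :=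
        congrArg (fun f : ℕ × (Fin N → ℕ) → ℝ => fun n => ‖f n‖) hE
      rwa [h4]
    · have h4 := (ht 0).of_norm.hasSum.mul h2 h3.of_norm
      rw [← (Fin.consEquiv (fun _ => ℕ)).hasSum_iff, hE]
      rwa [Fin.prod_univ_succ]

lemma hasSum_pi_prod {I : Type*} [Fintype I] (t : I → ℕ → ℝ)
    (ht : ∀ i, Summable fun k => ‖t i k‖) :
    HasSum (fun n : I → ℕ => ∏ i, t i (n i)) (∏ i, ∑' k, t i k) := by
  let e := Fintype.equivFin I
  have h := (summable_norm_and_hasSum_fin_prod (fun i => t (e.symm i)) fun i => ht (e.symm i)).2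
  have hprod : (fun n => ∏ i, t (e.symm i) (n i)) ∘ Equiv.piCongrLeft' (fun _ => ℕ) e =
      fun n : I → ℕ => ∏ i, t i (n i) :=
    funext fun n => Fintype.prod_equiv e.symm _ _ fun _ => rfl
  rwa [← (Equiv.piCongrLeft' (fun _ => ℕ) e).hasSum_iff, hprod,
    Fintype.prod_equiv e.symm (fun i => ∑' k, t (e.symm i) k) (fun i => ∑' k, t i k)
      fun _ => rfl] at h

lemma hasSum_pow_div_factorial (x : ℝ) : HasSum (fun k : ℕ => x ^ k / k !) (Real.exp x) := by
  rw [Real.exp_eq_exp_ℝ]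
  exact NormedSpace.expSeries_div_hasSum_exp x

/-- The factor at an edge of spin product `u` that corresponds to the value `k` of the current. -/
def currentFactor (a : ℝ) (k : ℕ) (u : ℤˣ) : ℝ := a ^ k / k ! * sgn u ^ k * Real.exp (-(a * sgn u))

variable {V : Type} [Fintype V] [DecidableEq V]

lemma weight_nonneg {β : ℝ} {K : Edge V → ℝ} (hK : ∀ e, 0 ≤ β * K e) (n : Current V) :
    0 ≤ weight β K n :=
  Finset.prod_nonneg fun e _ => div_nonneg (pow_nonneg (hK e) _) (Nat.cast_nonneg _)

/-- The sum of the weights of the currents in `S` with prescribed values on `F`, when the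
indicator of `S` is an average of products of signs. -/
lemma hasSum_indicator_weight {Y : Type*} (C : Finset Y) (χ : Edge V → Y → ℤˣ)
    {β : ℝ} {K : Edge V → ℝ} {S : Set (Current V)}
    (hS : ∀ n, S.indicator (fun _ => (1 : ℝ)) n =
      (C.card : ℝ)⁻¹ * ∑ σ ∈ C, ∏ e, sgn (χ e σ) ^ n e) (F : Finset (Edge V)) (m : Current V) :
    HasSum ({n | ∀ e ∈ F, n e = m e}.indicator (S.indicator (weight β K)))
      ((C.card : ℝ)⁻¹ * ∑ σ ∈ C, (∏ e ∈ F, currentFactor (β * K e) (m e) (χ e σ)) *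
        Real.exp (∑ e, β * K e * sgn (χ e σ))) := by
  -- One-edge series for fixed spins: on `F` only the prescribed value survives, elsewhere the whole
  -- exponential series. The factor exp(-a·u) in `currentFactor` restores the full Boltzmann weight
  -- in both cases.
  let t : Y → Edge V → ℕ → ℝ := fun σ e k =>
    if e ∈ F ∧ k ≠ m e then 0 else (β * K e * sgn (χ e σ)) ^ k / (k ! : ℝ)
  have htle : ∀ σ e k, ‖t σ e k‖ ≤ |β * K e| ^ k / (k ! : ℝ) := by
    intro σ e k
    simp only [t]
    split_ifs
    · simp; positivity
    · rw [norm_div, norm_pow, Real.norm_eq_abs, abs_mul, abs_sgn, mul_one]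
      simp
  have hts : ∀ σ e, Summable fun k => ‖t σ e k‖ := fun σ e =>
    Summable.of_nonneg_of_le (fun _ => norm_nonneg _) (htle σ e)
      (hasSum_pow_div_factorial _).summable
  have htsum : ∀ σ e, ∑' k, t σ e k =
      (if e ∈ F then currentFactor (β * K e) (m e) (χ e σ) else 1) *
        Real.exp (β * K e * sgn (χ e σ)) := by
    intro σ e
    by_cases he : e ∈ F
    · rw [tsum_eq_single (m e) fun k hk => by simp [t, he, hk]]
      simp only [t, he, ne_eq, not_true_eq_false, and_false, if_false, if_true, currentFactor]
      rw [mul_assoc _ (Real.exp _), ← Real.exp_add, neg_add_cancel, Real.exp_zero, mul_one, mul_pow]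
      ring
    · simp only [t, he, false_and, if_false, one_mul]
      exact (hasSum_pow_div_factorial _).tsum_eq
  have h1 : ∀ σ ∈ C, HasSum (fun n : Current V => ∏ e, t σ e (n e))
      ((∏ e ∈ F, currentFactor (β * K e) (m e) (χ e σ)) *
        Real.exp (∑ e, β * K e * sgn (χ e σ))) := by
    intro σ _
    have := hasSum_pi_prod (t σ) (hts σ)
    simp_rw [htsum] at this
    rwa [Finset.prod_mul_distrib, ← Real.exp_sum, Finset.prod_ite_mem, Finset.univ_inter] at this
  have h2 := (hasSum_sum h1).mul_left (C.card : ℝ)⁻¹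
  suffices h : {n | ∀ e ∈ F, n e = m e}.indicator (S.indicator (weight β K)) =
      fun n => (C.card : ℝ)⁻¹ * ∑ σ ∈ C, ∏ e, t σ e (n e) by rwa [h]
  ext n
  by_cases hn : ∀ e ∈ F, n e = m e
  · have h3 : ∀ σ, ∏ e, t σ e (n e) = weight β K n * ∏ e, sgn (χ e σ) ^ n e := by
      intro σ
      rw [weight, ← Finset.prod_mul_distrib]
      refine Finset.prod_congr rfl fun e _ => ?_
      simp only [t]
      rw [if_neg fun h => h.2 (hn e h.1), mul_pow]
      ring
    rw [Set.indicator_of_mem (by exact hn)]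
    simp_rw [h3]
    rw [← Finset.mul_sum, mul_left_comm, ← hS]
    by_cases hnS : n ∈ S <;> simp [hnS]
  · rw [Set.indicator_of_notMem (by exact hn)]
    push Not at hn
    obtain ⟨e, he, hne⟩ := hn
    rw [Finset.sum_eq_zero fun σ _ => Finset.prod_eq_zero (Finset.mem_univ e) (by simp [t, he, hne]),
      mul_zero]

/-- Ratio of the restricted sum to the case `F = ∅`, which is the partition function. Nonnegativity
of the mean needs recording: `ENNReal.ofReal` truncates, and the spin function itself can be
negative. -/
lemma lawOn_cylinder {Y : Type*} {C : Finset Y} (hC : C.Nonempty) (χ : Edge V → Y → ℤˣ)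
    {β : ℝ} {K : Edge V → ℝ} (hK : ∀ e, 0 ≤ β * K e) {S : Set (Current V)}
    (hS : ∀ n, S.indicator (fun _ => (1 : ℝ)) n =
      (C.card : ℝ)⁻¹ * ∑ σ ∈ C, ∏ e, sgn (χ e σ) ^ n e) (F : Finset (Edge V)) (m : Current V) :
    0 ≤ mean C (fun σ => Real.exp (∑ e, β * K e * sgn (χ e σ)))
        (fun σ => ∏ e ∈ F, currentFactor (β * K e) (m e) (χ e σ)) ∧
      lawOn β K S {n | ∀ e ∈ F, n e = m e} =
        ENNReal.ofReal (mean C (fun σ => Real.exp (∑ e, β * K e * sgn (χ e σ)))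
          fun σ => ∏ e ∈ F, currentFactor (β * K e) (m e) (χ e σ)) := by
  have hF := hasSum_indicator_weight C χ (β := β) (K := K) hS F m
  have hZ := hasSum_indicator_weight C χ (β := β) (K := K) hS ∅ m
  simp only [Finset.notMem_empty, false_imp_iff, implies_true, Set.ofPred_true,
    Set.indicator_univ, Finset.prod_empty, one_mul] at hZ
  have hC0 : (C.card : ℝ)⁻¹ ≠ 0 := inv_ne_zero (Nat.cast_ne_zero.2 hC.card_pos.ne')
  have hind : ∀ n, 0 ≤ S.indicator (weight β K) n :=
    fun n => Set.indicator_nonneg (fun n _ => weight_nonneg hK n) n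
  constructor
  · have h0 := hF.nonneg fun n => Set.indicator_nonneg (fun n _ => hind n) n
    exact div_nonneg (nonneg_of_mul_nonneg_right h0 (lt_of_le_of_ne (by positivity) hC0.symm))
      (Finset.sum_nonneg fun _ _ => (Real.exp_pos _).le)
  rw [lawOn, Measure.sum_apply _ (MeasurableSet.of_discrete), hZ.tsum_eq]
  have hpos : 0 ≤ (C.card : ℝ)⁻¹ * ∑ σ ∈ C, Real.exp (∑ e, β * K e * sgn (χ e σ)) :=
    mul_nonneg (by positivity) (Finset.sum_nonneg fun _ _ => (Real.exp_pos _).le)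
  have h1 : ∀ n : Current V, (ENNReal.ofReal (S.indicator (weight β K) n /
      ((C.card : ℝ)⁻¹ * ∑ σ ∈ C, Real.exp (∑ e, β * K e * sgn (χ e σ)))) • Measure.dirac n)
        {n | ∀ e ∈ F, n e = m e} =
      ENNReal.ofReal ({n | ∀ e ∈ F, n e = m e}.indicator (S.indicator (weight β K)) n /
        ((C.card : ℝ)⁻¹ * ∑ σ ∈ C, Real.exp (∑ e, β * K e * sgn (χ e σ)))) := by
    intro n
    rw [Measure.smul_apply, Measure.dirac_apply' _ MeasurableSet.of_discrete, smul_eq_mul]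
    by_cases hn : n ∈ {n : Current V | ∀ e ∈ F, n e = m e}
    · rw [Set.indicator_of_mem hn, Set.indicator_of_mem hn]; simp
    · rw [Set.indicator_of_notMem hn, Set.indicator_of_notMem hn]; simp
  simp_rw [h1]
  rw [← ENNReal.ofReal_tsum_of_nonneg
    (fun n => div_nonneg (Set.indicator_nonneg (fun n _ => hind n) n) hpos)
    (hF.summable.div_const _), tsum_div_const, hF.tsum_eq, mul_div_mul_left _ _ hC0, mean]

/-! ### Sourceless currents -/

lemma prod_bond_pow_mulSingle (n : Current V) (v : V) :
    ∏ e : Edge V, bond e.1 (Pi.mulSingle v (-1)) ^ n e =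
      (-1) ^ ∑ e : Edge V, if v ∈ e.1 then n e else 0 := by
  rw [← Finset.prod_pow_eq_pow_sum]
  refine Finset.prod_congr rfl fun e _ => ?_
  rw [bond_mulSingle]
  split_ifs <;> simp

/-- The indicator that a current has no sources in `U` is an average over spins. -/
lemma indicator_sources_eq {X : Type*} [CommGroup X] {C : Finset X}
    (hmul : ∀ a ∈ C, ∀ b ∈ C, a * b ∈ C) (hC : C.Nonempty) (θ : X →* (V → ℤˣ)) (U : Set V)
    (hU : ∀ v ∉ U, ∀ σ ∈ C, θ σ v = 1) (hU' : ∀ v ∈ U, ∃ σ ∈ C, θ σ = Pi.mulSingle v (-1))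
    (n : Current V) :
    {n : Current V | ∀ v ∈ U, v ∉ sources n}.indicator (fun _ => (1 : ℝ)) n =
      (C.card : ℝ)⁻¹ * ∑ σ ∈ C, ∏ e : Edge V, sgn (bond e.1 (θ σ)) ^ n e := by
  let Ψ : (V → ℤˣ) →* ℤˣ := ∏ e : Edge V, bond e.1 ^ n e
  have hΨ : ∀ s, Ψ s = ∏ e : Edge V, bond e.1 s ^ n e := fun s => by
    simp [Ψ, MonoidHom.finsetProd_apply]
  have h1 : ∀ σ, ∏ e : Edge V, sgn (bond e.1 (θ σ)) ^ n e = sgn ((Ψ.comp θ) σ) := fun σ => by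
    rw [MonoidHom.comp_apply, hΨ, sgn_prod]
    exact Finset.prod_congr rfl fun e _ => (sgn_pow _ _).symm
  simp_rw [h1]
  by_cases hn : ∀ v ∈ U, v ∉ sources n
  · rw [Set.indicator_of_mem (by exact hn)]
    -- A configuration is a product of single-site flips at vertices of `U`, and without sources
    -- there each flip leaves the character at 1.
    have h2 : ∀ σ ∈ C, sgn ((Ψ.comp θ) σ) = 1 := by
      intro σ hσ
      have h3 : Ψ (θ σ) = 1 := by
        rw [← Finset.univ_prod_mulSingle (θ σ), map_prod]
        refine Finset.prod_eq_one fun v _ => ?_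
        rcases Int.units_eq_one_or (θ σ v) with h | h
        · rw [h, Pi.mulSingle_one, map_one]
        · have hv : v ∈ U := by
            by_contra hv
            rw [hU v hv σ hσ] at h
            exact absurd h (by decide)
          rw [h, hΨ, prod_bond_pow_mulSingle]
          exact (Nat.not_odd_iff_even.1 (hn v hv)).neg_one_pow
      rw [MonoidHom.comp_apply, h3, sgn_one]
    rw [Finset.sum_congr rfl h2, Finset.sum_const, nsmul_eq_mul, mul_one,
      inv_mul_cancel₀ (Nat.cast_ne_zero.2 hC.card_pos.ne')]
  · rw [Set.indicator_of_notMem (by exact hn)]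
    push Not at hn
    obtain ⟨v, hv, hvn⟩ := hn
    obtain ⟨σ, hσ, hσv⟩ := hU' v hv
    -- The flip at a source has character -1 and belongs to `C`, so the average cancels.
    rw [sum_sgn_eq_zero hmul (Ψ.comp θ) hσ, mul_zero]
    rw [MonoidHom.comp_apply, hσv, hΨ, prod_bond_pow_mulSingle]
    exact Odd.neg_one_pow hvn

end Sums

/-! ### The laws of the currents in a finite volume -/

section BoxLaws

variable {d : ℕ} {J : Sym2 (Site d) → ℝ} {β : ℝ} {h : Site d → ℝ} {G : Finset (Site d)}

/-- The event that a configuration agrees with `m` on the finite set `E`. -/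
def cyl {S : Type*} (E : Finset (Edge (Site d))) (m : Edge (Site d) → S) :
    Set (Edge (Site d) → S) := {ω | ∀ e ∈ E, ω e = m e}

lemma extendCurrent_apply (n : Current G) (e : Edge G) :
    extendCurrent G n (e.map (Function.Embedding.subtype (· ∈ G))) = n e :=
  (Edge.map_injective _).extend_apply _ _ _

lemma extendCurrent_of_notMem (n : Current G) {e : Edge (Site d)} (he : e ∉ edgesIn G) :
    extendCurrent G n e = 0 := by
  refine Function.extend_apply' _ _ _ ?_
  rintro ⟨e', rfl⟩
  exact he (Finset.mem_map.2 ⟨e', Finset.mem_univ _, rfl⟩)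

variable {V : Type} [Fintype V] [DecidableEq V]

lemma measurable_extendCurrent (f : Edge G → Edge V) :
    Measurable fun n : Current V => extendCurrent G (n ∘ f) := measurable_of_countable _

lemma map_lawOn_cyl {K : Edge V → ℝ} (hK : ∀ e, 0 ≤ β * K e) {S : Set (Current V)}
    (χ : Edge V → (Site d → ℤˣ) → ℤˣ)
    (hS : ∀ n, S.indicator (fun _ => (1 : ℝ)) n =
      ((spinConfigs G).card : ℝ)⁻¹ * ∑ σ ∈ spinConfigs G, ∏ e, sgn (χ e σ) ^ n e)
    {f : Edge G → Edge V} (hf : Function.Injective f)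
    (hχ : ∀ e σ, χ (f e) σ = bond (e.map (Function.Embedding.subtype (· ∈ G))).1 σ)
    (hKf : ∀ e, K (f e) = J (e.map (Function.Embedding.subtype (· ∈ G))).1)
    (hw : ∀ σ, Real.exp (∑ e, β * K e * sgn (χ e σ)) = isingWeight J β h G σ)
    {E : Finset (Edge (Site d))} (hE : E ⊆ edgesIn G) (m : Current (Site d)) :
    0 ≤ isingMean J β h G (fun σ =>
        ∏ e ∈ E, currentFactor (β * J e.1) (m e) (bond e.1 σ)) ∧
      (lawOn β K S).map (fun n => extendCurrent G (n ∘ f)) (cyl E m) = ENNReal.ofReal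
        (isingMean J β h G fun σ => ∏ e ∈ E, currentFactor (β * J e.1) (m e) (bond e.1 σ)) := by
  classical
  let g : Edge G → Edge (Site d) := fun e => e.map (Function.Embedding.subtype (· ∈ G))
  let E' : Finset (Edge G) := Finset.univ.filter fun e => g e ∈ E
  have hg : Function.Injective g := Edge.map_injective _
  have hE' : E = E'.map ⟨g, hg⟩ := by
    ext e
    simp only [E', Finset.mem_map, Finset.mem_filter, Finset.mem_univ, true_and,
      Function.Embedding.coeFn_mk]
    constructor
    · intro he
      obtain ⟨e', -, he'⟩ := Finset.mem_map.1 (hE he)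
      exact ⟨e', (show g e' = e from he') ▸ he, he'⟩
    · rintro ⟨e', he', rfl⟩
      exact he'
  -- `m` transported along `f`. The default 0 applies only off the range of `f`, hence never to
  -- ghost edges that matter: none is prescribed.
  let m' : Current V := fun e => if h : ∃ e', f e' = e then m (g h.choose) else 0
  have hm' : ∀ e, m' (f e) = m (g e) := fun e => by
    have hex : ∃ e', f e' = f e := ⟨e, rfl⟩
    simp only [m', hex, dif_pos]
    rw [hf hex.choose_spec]
  have hpre : (fun n : Current V => extendCurrent G (n ∘ f)) ⁻¹' cyl E m =
      {n | ∀ e ∈ E'.map ⟨f, hf⟩, n e = m' e} := by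
    ext n
    rw [hE']
    simp only [cyl, Set.mem_preimage, Set.mem_ofPred_eq, Finset.forall_mem_map,
      Function.Embedding.coeFn_mk, hm']
    refine forall₂_congr fun e _ => ?_
    rw [extendCurrent_apply]
    rfl
  have hmeas : MeasurableSet (cyl E m) := by
    have : cyl E m = ⋂ e ∈ E, (fun ω => ω e) ⁻¹' {m e} := by
      ext; simp [cyl]
    rw [this]
    exact Finset.measurableSet_biInter _ fun e _ => measurable_pi_apply e (measurableSet_singleton _)
  have hmean : mean (spinConfigs G) (fun σ => Real.exp (∑ e, β * K e * sgn (χ e σ)))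
      (fun σ => ∏ e ∈ E'.map ⟨f, hf⟩, currentFactor (β * K e) (m' e) (χ e σ)) =
      isingMean J β h G fun σ => ∏ e ∈ E, currentFactor (β * J e.1) (m e) (bond e.1 σ) := by
    simp_rw [hw]
    rw [isingMean]
    congr 1
    ext σ
    conv_rhs => rw [hE']
    rw [Finset.prod_map, Finset.prod_map]
    exact Finset.prod_congr rfl fun e _ => by
      simp only [Function.Embedding.coeFn_mk, hm', hχ, hKf]
      rfl
  rw [Measure.map_apply (measurable_extendCurrent f) hmeas, hpre, ← hmean]
  exact lawOn_cylinder ⟨1, one_mem_spinConfigs G⟩ χ hK hS _ _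

/-- `ν` is the law of the sourceless current whose cylinder probabilities are mean values in the
Ising model on `G`. -/
structure IsCurrentLaw (J : Sym2 (Site d) → ℝ) (β : ℝ) (h : Site d → ℝ) (G : Finset (Site d))
    (ν : Measure (Current (Site d))) : Prop where
  cylinder : ∀ (E : Finset (Edge (Site d))) (m : Current (Site d)), E ⊆ edgesIn G →
    0 ≤ isingMean J β h G (fun σ => ∏ e ∈ E, currentFactor (β * J e.1) (m e) (bond e.1 σ)) ∧
      ν (cyl E m) = ENNReal.ofReal (isingMean J β h G fun σ =>
      ∏ e ∈ E, currentFactor (β * J e.1) (m e) (bond e.1 σ))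
  support : ∀ e ∉ edgesIn G, ν {ω | ω e ≠ 0} = 0

lemma map_lawOn_support (K : Edge V → ℝ) (S : Set (Current V)) (f : Edge G → Edge V)
    {e : Edge (Site d)} (he : e ∉ edgesIn G) :
    (lawOn β K S).map (fun n => extendCurrent G (n ∘ f)) {ω | ω e ≠ 0} = 0 := by
  have hmeas : MeasurableSet {ω : Current (Site d) | ω e ≠ 0} :=
    measurable_pi_apply e (measurableSet_singleton 0).compl
  have hpre : (fun n : Current V => extendCurrent G (n ∘ f)) ⁻¹' {ω | ω e ≠ 0} = ∅ := by
    ext n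
    simp [extendCurrent_of_notMem _ he]
  rw [Measure.map_apply (measurable_extendCurrent f) hmeas, hpre, measure_empty]

lemma mulSingle_val (v x : G) :
    (Pi.mulSingle v.1 (-1) : Site d → ℤˣ) x.1 = (Pi.mulSingle v (-1) : G → ℤˣ) x := by
  by_cases hx : x = v
  · rw [hx, Pi.mulSingle_eq_same, Pi.mulSingle_eq_same]
  · rw [Pi.mulSingle_eq_of_ne hx, Pi.mulSingle_eq_of_ne fun h' => hx (Subtype.ext h')]

theorem isCurrentLaw_free (hJ : ∀ e, 0 ≤ J e) (hβ : 0 ≤ β) (G : Finset (Site d)) :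
    IsCurrentLaw J β 0 G ((freeLaw J β G).map (extendCurrent G)) := by
  let θ : (Site d → ℤˣ) →* (G → ℤˣ) :=
    { toFun := fun σ x => σ x.1, map_one' := rfl, map_mul' := fun _ _ => rfl }
  have hset : {n : Current G | sources n = ∅} = {n | ∀ v ∈ Set.univ, v ∉ sources n} := by
    ext n
    simp [Set.eq_empty_iff_forall_notMem]
  refine ⟨fun E m hE => ?_, fun e he => map_lawOn_support _ _ id he⟩
  refine map_lawOn_cyl (f := id) (fun e => mul_nonneg hβ (hJ _)) (fun e σ => bond e.1 (θ σ))
    (fun n => ?_) Function.injective_id (fun e σ => ?_) (fun e => rfl) (fun σ => ?_) hE m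
  · rw [hset]
    refine indicator_sources_eq mul_mem_spinConfigs ⟨1, one_mem_spinConfigs G⟩ θ Set.univ
      (fun v hv => absurd (Set.mem_univ v) hv) (fun v _ => ?_) n
    refine ⟨Pi.mulSingle v.1 (-1), mulSingle_mem_spinConfigs v.2 _, ?_⟩
    exact funext fun x => mulSingle_val v x
  · rw [Edge.map, bond_map]
    rfl
  · rw [isingWeight, sum_edgesIn]
    simp only [Pi.zero_apply, mul_zero, zero_mul, Finset.sum_const_zero, add_zero, Edge.map,
      bond_map]
    rfl

lemma sum_edge_option {W : Type} [Fintype W] [DecidableEq W] (F : Sym2 (Option W) → ℝ) :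
    ∑ e : Edge (Option W), F e.1 =
      ∑ e : Edge W, F (e.1.map some) + ∑ x : W, F s(none, some x) := by
  have h1 : (Finset.univ : Finset (Edge (Option W))) =
      edgesIn (insert none (Finset.univ.map Function.Embedding.some)) := by
    ext e
    simp only [Finset.mem_univ, mem_edgesIn, true_iff]
    rintro (_ | x) _ <;> simp
  have h2 : edgesIn ((Finset.univ : Finset W).map Function.Embedding.some) =
      Finset.univ.map ⟨Edge.map Function.Embedding.some, Edge.map_injective _⟩ := by
    ext e
    simp only [mem_edgesIn, Finset.mem_map, Finset.mem_univ, true_and, Function.Embedding.coeFn_mk]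
    constructor
    · intro h
      obtain ⟨e, he⟩ := e
      induction e using Sym2.ind with
      | _ x y =>
        obtain ⟨x, rfl⟩ := h x (by simp)
        obtain ⟨y, rfl⟩ := h y (by simp)
        exact ⟨⟨s(x, y), by simpa using he⟩, rfl⟩
    · rintro ⟨e, rfl⟩ x hx
      obtain ⟨y, -, rfl⟩ := Sym2.mem_map.1 hx
      exact ⟨y, rfl⟩
  rw [h1, sum_edgesIn_insert (by simp), h2, Finset.sum_map, Finset.sum_map]
  rfl

/-- Imposing no parity at the ghost means not summing over its spin. With that spin equal to 1, the
ghost edges become the magnetic field. -/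
theorem isCurrentLaw_plus (hJ : ∀ e, 0 ≤ J e) (hβ : 0 ≤ β) (G : Finset (Site d)) :
    IsCurrentLaw J β (ghostCoupling J G) G
      ((plusLaw J β G).map fun n => extendCurrent G (forgetGhost G n)) := by
  let θ : (Site d → ℤˣ) →* (Option G → ℤˣ) :=
    { toFun := fun σ v => v.elim 1 fun x => σ x.1
      map_one' := by ext (_ | x) <;> rfl
      map_mul' := fun σ τ => by ext (_ | x) <;> simp }
  have hset : {n : Current (Option G) | {x : G | some x ∈ sources n} = ∅} =
      {n | ∀ v ∈ Set.range some, v ∉ sources n} := by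
    ext n
    simp only [Set.eq_empty_iff_forall_notMem, Set.mem_ofPred_eq, Set.forall_mem_range]
  have hg : ∀ x, 0 ≤ ghostCoupling J G x := fun x => tsum_nonneg fun y => hJ _
  have hK : ∀ e : Edge (Option G), 0 ≤ plusCoupling J G e := by
    rintro ⟨e, he⟩
    induction e using Sym2.ind with
    | _ x y =>
      rcases x with _ | x <;> rcases y with _ | y
      · exact le_rfl
      · exact hg y
      · exact hg x
      · exact hJ _
  refine ⟨fun E m hE => ?_,
    fun e he => map_lawOn_support _ _ (Edge.map Function.Embedding.some) he⟩
  refine map_lawOn_cyl (f := Edge.map Function.Embedding.some) (fun e => mul_nonneg hβ (hK e))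
    (fun e σ => bond e.1 (θ σ)) (fun n => ?_) (Edge.map_injective _) (fun e σ => ?_)
    (fun e => ?_) (fun σ => ?_) hE m
  · rw [hset]
    refine indicator_sources_eq mul_mem_spinConfigs ⟨1, one_mem_spinConfigs G⟩ θ (Set.range some)
      (fun v hv σ _ => ?_) ?_ n
    · rcases v with _ | v
      · rfl
      · exact absurd ⟨v, rfl⟩ hv
    · rintro _ ⟨v, rfl⟩
      refine ⟨Pi.mulSingle v.1 (-1), mulSingle_mem_spinConfigs v.2 _, ?_⟩
      funext x
      rcases x with _ | x
      · rw [Pi.mulSingle_eq_of_ne (Option.some_ne_none v).symm]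
        rfl
      · refine (mulSingle_val v x).trans ?_
        by_cases hx : x = v
        · rw [hx, Pi.mulSingle_eq_same, Pi.mulSingle_eq_same]
        · rw [Pi.mulSingle_eq_of_ne hx, Pi.mulSingle_eq_of_ne fun h' => hx (Option.some_injective _ h')]
  · rw [Edge.map, Edge.map, bond_map, bond_map]
    rfl
  · obtain ⟨e, he⟩ := e
    induction e using Sym2.ind with
    | _ x y => rfl
  · let P : Sym2 (Option G) → ℝ := fun s => if hs : ¬ s.IsDiag then plusCoupling J G ⟨s, hs⟩ else 0
    have hP : ∀ e : Edge (Option G), plusCoupling J G e = P e.1 := fun e => by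
      simp [P, e.2]
    simp_rw [hP]
    rw [isingWeight, sum_edgesIn, sum_edge_option fun s => β * P s * sgn (bond s (θ σ))]
    congr 2
    · refine Finset.sum_congr rfl fun e _ => ?_
      have h1 : P (e.1.map some) = J (e.map (Function.Embedding.subtype (· ∈ G))).1 := by
        rw [show e.1.map some = (e.map Function.Embedding.some).1 from rfl, ← hP]
        obtain ⟨e, he⟩ := e
        induction e using Sym2.ind with
        | _ x y => rfl
      rw [h1, Edge.map, bond_map, bond_map]
      rfl
    · rw [← Finset.sum_coe_sort G]
      refine Finset.sum_congr rfl fun x _ => ?_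
      have h1 : P s(none, some x) = ghostCoupling J G x.1 := by
        have hs : ¬ (s(none, some x) : Sym2 (Option G)).IsDiag := by simp
        exact (hP ⟨_, hs⟩).symm
      rw [h1, bond_mk]
      simp [θ]

lemma IsCurrentLaw.isProbabilityMeasure {ν : Measure (Current (Site d))}
    (hν : IsCurrentLaw J β h G ν) : IsProbabilityMeasure ν := by
  have := (hν.cylinder ∅ 0 (Finset.empty_subset _)).2
  simp only [cyl, Finset.notMem_empty, false_imp_iff, implies_true, Set.ofPred_true,
    Finset.prod_empty, isingMean_const, ENNReal.ofReal_one] at this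
  exact ⟨this⟩

end BoxLaws

/-! ### Concentration of averages of spin observables -/

section Concentration

/-- From log(1 + u) ≥ u/(1 + u). It converts products of 1 + aY into exponentials of sums at a
second-order cost. -/
lemma exp_sub_two_mul_sq_le {u : ℝ} (hu : |u| ≤ 1 / 2) : Real.exp (u - 2 * u ^ 2) ≤ 1 + u := by
  have h1 := (abs_le.1 hu).1
  have h0 : 0 < 1 + u := by linarith
  rw [← Real.le_log_iff_exp_le h0]
  refine le_trans ?_ (Real.one_sub_inv_le_log_of_pos h0)
  rw [le_sub_iff_add_le, ← le_sub_iff_add_le', inv_le_iff_one_le_mul₀ h0]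
  nlinarith [mul_nonneg (sq_nonneg u) (by linarith : 0 ≤ 1 + 2 * u)]

variable {V : Type} [DecidableEq V] {J : Sym2 V → ℝ} {β : ℝ} {h : V → ℝ} {G : Finset V}

lemma isingMean_add (f g : (V → ℤˣ) → ℝ) :
    isingMean J β h G (fun σ => f σ + g σ) = isingMean J β h G f + isingMean J β h G g :=
  mean_add _ _ f g

lemma isingMean_const_mul (c : ℝ) (f : (V → ℤˣ) → ℝ) :
    isingMean J β h G (fun σ => c * f σ) = c * isingMean J β h G f :=
  mean_const_mul _ _ c f

lemma isingMean_sum {ι : Type*} (s : Finset ι) (f : ι → (V → ℤˣ) → ℝ) :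
    isingMean J β h G (fun σ => ∑ i ∈ s, f i σ) = ∑ i ∈ s, isingMean J β h G (f i) :=
  mean_sum s _ _ f

/-- A one-sided exponential bound and a bound on the mean give concentration. -/
lemma isingMean_abs_le_of_prod_le {T : Type*} {t : Finset T} {Y : T → (V → ℤˣ) → ℝ}
    (hY : ∀ y σ, |Y y σ| = 1) {M η a : ℝ} (hM : |M| ≤ 1) (ha : 0 < a)
    (ha2 : a ≤ 1 / 2) (haη : a ≤ η / 2) (ht : 0 < t.card)
    (hprod : isingMean J β h G (fun σ => ∏ y ∈ t, (1 + a * Y y σ)) ≤ (1 + a * (M + η)) ^ t.card)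
    (hmean : M - η ≤ isingMean J β h G (fun σ => (t.card : ℝ)⁻¹ * ∑ y ∈ t, Y y σ)) :
    isingMean J β h G (fun σ => |(t.card : ℝ)⁻¹ * ∑ y ∈ t, Y y σ - M|) ≤
      5 * η + 2 * (a * t.card)⁻¹ := by
  set N : ℝ := (t.card : ℝ) with hN
  have hN0 : 0 < N := by rw [hN]; exact_mod_cast ht
  set Z : (V → ℤˣ) → ℝ := fun σ => N⁻¹ * ∑ y ∈ t, Y y σ - M with hZ
  have haN : 0 < a * N := mul_pos ha hN0
  -- One η comes from the hypothesis on the product; the other pays for the loss 2a² per factor,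
  -- since a ≤ η/2.
  have hexp : isingMean J β h G (fun σ => Real.exp (a * N * (Z σ - 2 * η))) ≤ 1 := by
    have h1 : ∀ σ, Real.exp (a * N * (Z σ - 2 * η)) ≤
        Real.exp (-(a * N * (M + η))) * ∏ y ∈ t, (1 + a * Y y σ) := by
      intro σ
      have h2 : Real.exp (∑ y ∈ t, (a * Y y σ - 2 * a ^ 2)) ≤ ∏ y ∈ t, (1 + a * Y y σ) := by
        rw [Real.exp_sum]
        refine Finset.prod_le_prod (fun _ _ => (Real.exp_pos _).le) fun y _ => ?_
        have hsq : (Y y σ) ^ 2 = 1 := by rw [← sq_abs, hY, one_pow]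
        have := exp_sub_two_mul_sq_le (u := a * Y y σ)
          (by rwa [abs_mul, hY, mul_one, abs_of_pos ha])
        rwa [mul_pow, hsq, mul_one] at this
      refine le_trans ?_ (mul_le_mul_of_nonneg_left h2 (Real.exp_pos _).le)
      rw [← Real.exp_add, Real.exp_le_exp, Finset.sum_sub_distrib, ← Finset.mul_sum,
        Finset.sum_const, nsmul_eq_mul, ← hN]
      have h3 : a * N * (Z σ - 2 * η) = a * ∑ y ∈ t, Y y σ - a * N * (M + 2 * η) := by
        simp only [hZ]; field_simp; ring
      rw [h3]
      nlinarith [mul_nonneg haN.le (by linarith : 0 ≤ η - 2 * a)]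
    refine (isingMean_mono h1).trans ?_
    rw [isingMean_const_mul]
    have h4 : (1 + a * (M + η)) ^ t.card ≤ Real.exp (a * N * (M + η)) := by
      have h5 : Real.exp (a * N * (M + η)) = Real.exp (a * (M + η)) ^ t.card := by
        rw [← Real.exp_nat_mul]; congr 1; rw [← hN]; ring
      rw [h5]
      refine pow_le_pow_left₀ ?_ (by linarith [Real.add_one_le_exp (a * (M + η))]) _
      nlinarith [(abs_le.1 hM).1]
    calc _ ≤ Real.exp (-(a * N * (M + η))) * Real.exp (a * N * (M + η)) :=
          mul_le_mul_of_nonneg_left (hprod.trans h4) (Real.exp_pos _).le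
      _ = 1 := by rw [← Real.exp_add, neg_add_cancel, Real.exp_zero]
  -- |Z| = 2Z⁺ - Z: the exponential controls the positive part, and the lower bound on the mean
  -- controls -Z.
  have hpt : ∀ σ, |Z σ| ≤ (4 * η + 2 * (a * N)⁻¹ * Real.exp (a * N * (Z σ - 2 * η))) +
      (-1) * Z σ := by
    intro σ
    have h1 := Real.add_one_le_exp (a * N * (Z σ - 2 * η))
    have h2 : Z σ - 2 * η ≤ (a * N)⁻¹ * Real.exp (a * N * (Z σ - 2 * η)) := by
      rw [le_inv_mul_iff₀ haN]; linarith
    have h3 : 0 ≤ (a * N)⁻¹ * Real.exp (a * N * (Z σ - 2 * η)) := by positivity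
    rcases abs_cases (Z σ) with h | h <;> rw [h.1] <;> linarith
  refine (isingMean_mono hpt).trans ?_
  rw [isingMean_add, isingMean_add, isingMean_const, isingMean_const_mul, isingMean_const_mul]
  have hZm : -η ≤ isingMean J β h G Z := by
    have : isingMean J β h G Z =
        isingMean J β h G (fun σ => N⁻¹ * ∑ y ∈ t, Y y σ) + -M := by
      rw [← isingMean_const (J := J) (β := β) (h := h) (G := G) (-M), ← isingMean_add]
      simp only [hZ, sub_eq_add_neg]
    rw [this]; linarith
  have h6 : 2 * (a * N)⁻¹ * isingMean J β h G (fun σ => Real.exp (a * N * (Z σ - 2 * η))) ≤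
      2 * (a * N)⁻¹ * 1 := mul_le_mul_of_nonneg_left hexp (by positivity)
  linarith

end Concentration

section Lattice

variable {d : ℕ} {J : Sym2 (Site d) → ℝ} {β : ℝ} {h : ℕ → Site d → ℝ}
  {Φ : Finset (Edge (Site d)) → ℝ}

lemma IsSpinLimit.abs_le_one (hΦ : IsSpinLimit J β h Φ) (S : Finset (Edge (Site d))) :
    |Φ S| ≤ 1 :=
  le_of_tendsto (hΦ.tendsto S 0).abs
    (Eventually.of_forall fun _ => abs_isingMean_le fun σ => (abs_obs _ σ).le)

/-- Averages of distant translates of a product of edge spins concentrate. -/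
lemma IsSpinLimit.eventually_mean_abs_le (hΦ : IsSpinLimit J β h Φ) {S : Finset (Edge (Site d))}
    (hS : ∀ e ∈ S, 0 < J e.1) {ε : ℝ} (hε : 0 < ε) :
    ∃ N₀ : ℕ, ∀ T : Finset (Site d), N₀ ≤ T.card →
      (T : Set (Site d)).PairwiseDisjoint (fun y => shiftEdges y S) →
      ∀ᶠ L in atTop, isingMean J β (h L) (box d L)
        (fun σ => |(T.card : ℝ)⁻¹ * ∑ y ∈ T, obs (shiftEdges y S) σ - Φ S|) ≤ ε := by
  obtain ⟨s, hs, H⟩ := hΦ.tilt S hS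
  -- With η = ε/10 the term 5η is ε/2; the choice of `N₀` below makes 2/(aN) at most ε/2.
  obtain ⟨a₀, ha₀, H⟩ := H (ε / 10) (by positivity)
  set a := min a₀ (min (1 / 2) (ε / 10 / 2)) with ha
  have ha0 : 0 < a := lt_min ha₀ (lt_min (by norm_num) (by positivity))
  obtain ⟨N₀, hN₀⟩ := exists_nat_gt (4 / (a * ε))
  have hN₀0 : (0 : ℝ) < N₀ := lt_of_le_of_lt (by positivity) hN₀
  refine ⟨N₀, fun T hT hd => ?_⟩
  have hTN : (N₀ : ℝ) ≤ T.card := by exact_mod_cast hT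
  have hT0 : (0 : ℝ) < T.card := hN₀0.trans_le hTN
  have hmean : Tendsto (fun L => isingMean J β (h L) (box d L)
      (fun σ => (T.card : ℝ)⁻¹ * ∑ y ∈ T, s * obs (shiftEdges y S) σ)) atTop (𝓝 (s * Φ S)) := by
    simp_rw [isingMean_const_mul, isingMean_sum, isingMean_const_mul]
    have := (tendsto_finsetSum T fun y _ => (hΦ.tendsto S y).const_mul s).const_mul (T.card : ℝ)⁻¹
    rwa [Finset.sum_const, nsmul_eq_mul, inv_mul_cancel_left₀ hT0.ne'] at this
  filter_upwards [H a ha0 (min_le_left _ _) T hd,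
    hmean.eventually (lt_mem_nhds (show s * Φ S - ε / 10 < s * Φ S by linarith))] with L h1 h2
  have key := isingMean_abs_le_of_prod_le (Y := fun y σ => s * obs (shiftEdges y S) σ) (t := T)
    (fun y σ => by rw [abs_mul, hs, abs_obs, one_mul]) (M := s * Φ S) (η := ε / 10) (a := a)
    (by rw [abs_mul, hs, one_mul]; exact hΦ.abs_le_one S) ha0
    ((min_le_right _ _).trans (min_le_left _ _)) ((min_le_right _ _).trans (min_le_right _ _))
    (by exact_mod_cast hT0) h1 h2.le
  have h3 : ∀ σ : Site d → ℤˣ, |(T.card : ℝ)⁻¹ * ∑ y ∈ T, obs (shiftEdges y S) σ - Φ S| =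
      |(T.card : ℝ)⁻¹ * ∑ y ∈ T, s * obs (shiftEdges y S) σ - s * Φ S| := by
    intro σ
    rw [← Finset.mul_sum, mul_left_comm, ← mul_sub, abs_mul, hs, one_mul]
  simp_rw [h3]
  refine key.trans ?_
  have h4 : (a * T.card)⁻¹ ≤ ε / 4 := by
    rw [inv_le_comm₀ (by positivity) (by positivity), inv_div]
    rw [div_lt_iff₀ (by positivity)] at hN₀
    rw [div_le_iff₀ hε]
    nlinarith [mul_le_mul_of_nonneg_left hTN (mul_pos ha0 hε).le]
  linarith

/-- In positive dimension a finite set of edges has any number of disjoint translates. -/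
lemma exists_disjoint_shiftEdges [Infinite (Site d)] (E : Finset (Edge (Site d))) (N : ℕ) :
    ∃ T : Finset (Site d), T.card = N ∧
      (T : Set (Site d)).PairwiseDisjoint fun y => shiftEdges y E := by
  classical
  obtain ⟨W, hW⟩ := exists_subset_edgesIn E
  induction N with
  | zero => exact ⟨∅, rfl, by simp⟩
  | succ N ih =>
    obtain ⟨T, hT, hd⟩ := ih
    -- The translates W + x and W + y meet exactly when x = w + y - w' with w, w' ∈ W, so only
    -- finitely many x are excluded.
    obtain ⟨x, hx⟩ := Infinite.exists_notMem_finset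
      (T ∪ ((W ×ˢ W) ×ˢ T).image fun p => p.1.1 + p.2 - p.1.2)
    simp only [Finset.mem_union, Finset.mem_image, Finset.mem_product, not_or] at hx
    refine ⟨insert x T, by rw [Finset.card_insert_of_notMem hx.1, hT], ?_⟩
    rw [Finset.coe_insert]
    refine hd.insert fun y hy _ => ?_
    rw [Finset.disjoint_left]
    intro e he he'
    have hsub : ∀ z, shiftEdges z E ⊆ edgesIn (shiftSites z W) := fun z => by
      rw [← shiftEdges_edgesIn]
      exact Finset.map_subset_map.2 hW
    have hx1 := hsub x he
    have hy1 := hsub y he'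
    obtain ⟨v, hv⟩ : ∃ v, v ∈ e.1 := by
      obtain ⟨e, _⟩ := e
      induction e using Sym2.ind with
      | _ a b => exact ⟨a, by simp⟩
    have hvx := mem_shiftSites.1 (mem_edgesIn.1 hx1 v hv)
    have hvy := mem_shiftSites.1 (mem_edgesIn.1 hy1 v hv)
    exact hx.2 ⟨((v - y, v - x), y), ⟨⟨hvy, hvx⟩, hy⟩, by simp⟩

/-! ### The spin functions of cylinder events -/

/-- The function of the spins whose mean is the probability of a cylinder event. -/
def cylFun (J : Sym2 (Site d) → ℝ) (β : ℝ) (E : Finset (Edge (Site d))) (m : Current (Site d))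
    (σ : Site d → ℤˣ) : ℝ := ∏ e ∈ E, currentFactor (β * J e.1) (m e) (bond e.1 σ)

/-- Every function of a sign is affine. At coupling 0 the factor is constant, which later removes
edges of zero coupling, where the tilting bound is unavailable. -/
lemma exists_currentFactor_eq (a : ℝ) (k : ℕ) :
    ∃ p q : ℝ, (a = 0 → q = 0) ∧ ∀ u, currentFactor a k u = q * sgn u + p := by
  refine ⟨(currentFactor a k 1 + currentFactor a k (-1)) / 2,
    (currentFactor a k 1 - currentFactor a k (-1)) / 2, ?_, fun u => ?_⟩
  · rintro rfl
    rcases k with _ | k <;> simp [currentFactor]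
  · rcases Int.units_eq_one_or u with rfl | rfl
    · rw [sgn_one]; ring
    · rw [sgn_neg_one]; ring

lemma exists_cylFun_eq (J : Sym2 (Site d) → ℝ) (hJ : ∀ e, 0 ≤ J e) (β : ℝ)
    (E : Finset (Edge (Site d))) (m : Current (Site d)) :
    ∃ c : Finset (Edge (Site d)) → ℝ, (∀ S, c S ≠ 0 → ∀ e ∈ S, 0 < J e.1) ∧
      ∀ σ, cylFun J β E m σ = ∑ S ∈ E.powerset, c S * obs S σ := by
  classical
  choose p q hq hpq using fun e : Edge (Site d) => exists_currentFactor_eq (β * J e.1) (m e)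
  refine ⟨fun S => (∏ e ∈ S, q e) * ∏ e ∈ E \ S, p e, fun S hS e he => ?_, fun σ => ?_⟩
  · refine (hJ e.1).lt_of_ne' fun h0 => hS ?_
    beta_reduce
    rw [Finset.prod_eq_zero he (hq e (by rw [h0, mul_zero])), zero_mul]
  · simp_rw [cylFun, hpq]
    rw [Finset.prod_add]
    refine Finset.sum_congr rfl fun S _ => ?_
    rw [Finset.prod_mul_distrib, obs]
    ring

lemma shift_neg_map {S : Type} (m : Edge (Site d) → S) (x : Site d) (e : Edge (Site d)) :
    shift (-x) m (e.map (Equiv.addRight x).toEmbedding) = m e := by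
  rw [shift]
  congr 1
  apply Subtype.ext
  have : (Equiv.addRight (-x)).toEmbedding ∘ (Equiv.addRight x).toEmbedding = id := by
    funext z
    simp
  change Sym2.map _ (Sym2.map _ e.1) = e.1
  rw [Sym2.map_map, this, Sym2.map_id, id]

lemma cylFun_shift (hJ : IsCoupling J) (β : ℝ) (E : Finset (Edge (Site d)))
    (m : Current (Site d)) (x : Site d) (σ : Site d → ℤˣ) :
    cylFun J β (shiftEdges x E) (shift (-x) m) σ = cylFun J β E m (σ ∘ (· + x)) := by
  simp only [cylFun, shiftEdges, Finset.prod_map, Function.Embedding.coeFn_mk]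
  refine Finset.prod_congr rfl fun e _ => ?_
  have h2 : J (e.map (Equiv.addRight x).toEmbedding).1 = J e.1 := hJ.map_add x e.1
  rw [shift_neg_map, h2, Edge.map, bond_map]
  rfl

/-- Averages of distant translates of the spin function of a cylinder event concentrate. -/
lemma IsSpinLimit.exists_cylFun_limit (hJ : IsCoupling J) (hΦ : IsSpinLimit J β h Φ)
    (E : Finset (Edge (Site d))) (m : Current (Site d)) :
    ∃ p : ℝ, (∀ x, Tendsto (fun L => isingMean J β (h L) (box d L)
        fun σ => cylFun J β E m (σ ∘ (· + x))) atTop (𝓝 p)) ∧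
      ∀ ε > 0, ∃ N₀ : ℕ, ∀ T : Finset (Site d), N₀ ≤ T.card →
        (T : Set (Site d)).PairwiseDisjoint (fun y => shiftEdges y E) →
        ∀ᶠ L in atTop, isingMean J β (h L) (box d L)
          (fun σ => ((T.card : ℝ)⁻¹ * ∑ y ∈ T, cylFun J β E m (σ ∘ (· + y)) - p) ^ 2) ≤ ε := by
  obtain ⟨c, hc, hF⟩ := exists_cylFun_eq J hJ.nonneg' β E m
  simp_rw [hF, ← obs_shiftEdges]
  refine ⟨∑ S ∈ E.powerset, c S * Φ S, fun x => ?_, fun ε hε => ?_⟩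
  · simp_rw [isingMean_sum, isingMean_const_mul]
    exact tendsto_finsetSum _ fun S _ => (hΦ.tendsto S x).const_mul _
  set B : ℝ := ∑ S ∈ E.powerset, |c S| with hB
  have hB0 : 0 ≤ B := Finset.sum_nonneg fun _ _ => abs_nonneg _
  -- Each deviation is at most 2, so the squared sum is at most 2B times the weighted L¹ deviations,
  -- in total 2B²ε'. The +1 avoids division by zero.
  set ε' := ε / (2 * B * B + 1) with hε'
  have hε'0 : 0 < ε' := by positivity
  have H : ∀ S ∈ E.powerset, ∃ N₀ : ℕ, ∀ T : Finset (Site d), N₀ ≤ T.card →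
      (T : Set (Site d)).PairwiseDisjoint (fun y => shiftEdges y E) →
      ∀ᶠ L in atTop, |c S| * isingMean J β (h L) (box d L)
        (fun σ => |(T.card : ℝ)⁻¹ * ∑ y ∈ T, obs (shiftEdges y S) σ - Φ S|) ≤ |c S| * ε' := by
    intro S hS
    by_cases h0 : c S = 0
    · exact ⟨0, fun T _ _ => by simp [h0]⟩
    · obtain ⟨N₀, H⟩ := hΦ.eventually_mean_abs_le (hc S h0) hε'0
      refine ⟨N₀, fun T hT hd => (H T hT ?_).mono fun L hL =>
        mul_le_mul_of_nonneg_left hL (abs_nonneg _)⟩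
      exact hd.mono fun y => Finset.map_subset_map.2 (Finset.mem_powerset.1 hS)
  choose! N₀ H using H
  refine ⟨E.powerset.sup N₀ + 1, fun T hT hd => ?_⟩
  have hT0 : (0 : ℝ) < T.card := by exact_mod_cast (Nat.succ_pos _).trans_le hT
  filter_upwards [(eventually_all_finset E.powerset).2 fun S hS =>
    H S hS T ((Finset.le_sup hS).trans ((Nat.le_succ _).trans hT)) hd] with L hL
  set u : Finset (Edge (Site d)) → (Site d → ℤˣ) → ℝ :=
    fun S σ => (T.card : ℝ)⁻¹ * ∑ y ∈ T, obs (shiftEdges y S) σ - Φ S with hu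
  have hu2 : ∀ S σ, |u S σ| ≤ 2 := by
    intro S σ
    have h1 : |(T.card : ℝ)⁻¹ * ∑ y ∈ T, obs (shiftEdges y S) σ| ≤ 1 := by
      rw [abs_mul, abs_of_pos (inv_pos.2 hT0), inv_mul_le_iff₀ hT0]
      refine (Finset.abs_sum_le_sum_abs _ _).trans ?_
      simp [abs_obs]
    exact (abs_sub _ _).trans (by linarith [hΦ.abs_le_one S])
  have hrw : ∀ σ, (T.card : ℝ)⁻¹ * ∑ y ∈ T, ∑ S ∈ E.powerset, c S * obs (shiftEdges y S) σ -
      ∑ S ∈ E.powerset, c S * Φ S = ∑ S ∈ E.powerset, c S * u S σ := by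
    intro σ
    rw [Finset.sum_comm, Finset.mul_sum, ← Finset.sum_sub_distrib]
    refine Finset.sum_congr rfl fun S _ => ?_
    rw [hu, ← Finset.mul_sum]
    ring
  simp_rw [hrw]
  have hpt : ∀ σ, (∑ S ∈ E.powerset, c S * u S σ) ^ 2 ≤
      2 * B * ∑ S ∈ E.powerset, |c S| * |u S σ| := by
    intro σ
    have h1 : |∑ S ∈ E.powerset, c S * u S σ| ≤ ∑ S ∈ E.powerset, |c S| * |u S σ| :=
      (Finset.abs_sum_le_sum_abs _ _).trans (Finset.sum_le_sum fun S _ => (abs_mul _ _).le)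
    have h2 : |∑ S ∈ E.powerset, c S * u S σ| ≤ 2 * B := by
      refine h1.trans ?_
      rw [hB, Finset.mul_sum]
      exact Finset.sum_le_sum fun S _ => by nlinarith [abs_nonneg (c S), hu2 S σ]
    rw [← sq_abs, sq]
    exact mul_le_mul h2 h1 (abs_nonneg _) (by positivity)
  refine (isingMean_mono hpt).trans ?_
  rw [isingMean_const_mul, isingMean_sum]
  simp_rw [isingMean_const_mul]
  have h3 : ∑ S ∈ E.powerset, |c S| * isingMean J β (h L) (box d L) (fun σ => |u S σ|) ≤ B * ε' := by
    rw [hB, Finset.sum_mul]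
    exact Finset.sum_le_sum fun S hS => hL S hS
  calc _ ≤ 2 * B * (B * ε') := mul_le_mul_of_nonneg_left h3 (by positivity)
    _ = (2 * B * B) * ε' := by ring
    _ ≤ (2 * B * B + 1) * ε' := by nlinarith
    _ = ε := by rw [hε']; field_simp

end Lattice

/-! ### Cylinder events -/

section Cylinders

variable {d : ℕ}

lemma measurableSet_cyl {S : Type*} [MeasurableSpace S] [MeasurableSingletonClass S]
    (E : Finset (Edge (Site d))) (m : Edge (Site d) → S) : MeasurableSet (cyl E m) := by
  have : cyl E m = ⋂ e ∈ E, (fun ω => ω e) ⁻¹' {m e} := by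
    ext; simp [cyl]
  rw [this]
  exact Finset.measurableSet_biInter _ fun e _ => measurable_pi_apply e (measurableSet_singleton _)

lemma shift_preimage_cyl {S : Type} (x : Site d) (E : Finset (Edge (Site d)))
    (m : Edge (Site d) → S) : shift x ⁻¹' cyl E m = cyl (shiftEdges x E) (shift (-x) m) := by
  ext ω
  simp only [cyl, shiftEdges, Set.mem_preimage, Set.mem_ofPred_eq, Finset.forall_mem_map,
    Function.Embedding.coeFn_mk, shift_neg_map]
  rfl

lemma measurable_shift {S : Type} [MeasurableSpace S] (x : Site d) :
    Measurable (shift x : (Edge (Site d) → S) → _) :=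
  measurable_pi_lambda _ fun _ => measurable_pi_apply _

lemma cyl_inter_eq {S : Type*} [DecidableEq (Edge (Site d))] {E E' : Finset (Edge (Site d))}
    {m m' ω : Edge (Site d) → S} (hω : ω ∈ cyl E m ∩ cyl E' m') :
    cyl E m ∩ cyl E' m' = cyl (E ∪ E') ω := by
  ext ω'
  simp only [cyl, Set.mem_inter_iff, Set.mem_ofPred_eq, Finset.mem_union] at hω ⊢
  constructor
  · rintro ⟨h, h'⟩ e (he | he)
    · rw [h e he, hω.1 e he]
    · rw [h' e he, hω.2 e he]
  · intro h
    exact ⟨fun e he => by rw [h e (Or.inl he), hω.1 e he],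
      fun e he => by rw [h e (Or.inr he), hω.2 e he]⟩

/-- The cylinder events of the lattice. -/
def cylinders (d : ℕ) : Set (Set (Current (Site d))) := {A | ∃ E m, A = cyl E m}

lemma isPiSystem_cylinders : IsPiSystem (cylinders d) := by
  rintro _ ⟨E, m, rfl⟩ _ ⟨E', m', rfl⟩ ⟨ω, hω⟩
  exact ⟨_, _, cyl_inter_eq hω⟩

lemma generateFrom_cylinders :
    (MeasurableSpace.pi : MeasurableSpace (Current (Site d))) =
      MeasurableSpace.generateFrom (cylinders d) := by
  apply le_antisymm
  · refine iSup_le fun e => Measurable.comap_le ?_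
    refine @measurable_to_countable' _ _ _ _ (MeasurableSpace.generateFrom (cylinders d)) _
      fun k => MeasurableSpace.measurableSet_generateFrom ⟨{e}, fun _ => k, ?_⟩
    ext ω
    simp [cyl]
  · refine MeasurableSpace.generateFrom_le ?_
    rintro _ ⟨E, m, rfl⟩
    exact measurableSet_cyl E m

lemma measure_eq_of_cyl {μ μ' : Measure (Current (Site d))} [IsProbabilityMeasure μ]
    [IsProbabilityMeasure μ'] (h : ∀ E m, μ (cyl E m) = μ' (cyl E m)) : μ = μ' := by
  refine ext_of_generate_finite _ generateFrom_cylinders isPiSystem_cylinders ?_ (by simp)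
  rintro _ ⟨E, m, rfl⟩
  exact h E m

/-- Gives local events an empty frontier, so that weak convergence implies convergence of their
probabilities. -/
lemma isClopen_of_dependsOn {S : Type*} [TopologicalSpace S] [DiscreteTopology S]
    {E : Finset (Edge (Site d))} {A : Set (Edge (Site d) → S)}
    (hA : DependsOn (fun ω => ω ∈ A) (E : Set (Edge (Site d)))) : IsClopen A := by
  have hopen : ∀ ω : Edge (Site d) → S, cyl E ω ∈ 𝓝 ω := by
    intro ω
    have : cyl E ω = ⋂ e ∈ E, (fun ω' => ω' e) ⁻¹' {ω e} := by
      ext; simp [cyl]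
    rw [this]
    exact (Finset.iInter_mem_sets E).2 fun e _ =>
      (continuous_apply e).continuousAt.preimage_mem_nhds (by simp)
  have hiff : ∀ ω, ∀ ω' ∈ cyl E ω, (ω' ∈ A ↔ ω ∈ A) := fun ω ω' h => by
    have := @hA ω' ω fun e he => h e he
    simpa using this
  constructor
  · rw [← isOpen_compl_iff, isOpen_iff_mem_nhds]
    exact fun ω hω => mem_of_superset (hopen ω) fun ω' h h' => hω ((hiff ω ω' h).1 h')
  · rw [isOpen_iff_mem_nhds]
    exact fun ω hω => mem_of_superset (hopen ω) fun ω' h => (hiff ω ω' h).2 hω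

lemma dependsOn_cyl {S : Type*} (E : Finset (Edge (Site d))) (m : Edge (Site d) → S) :
    DependsOn (fun ω => ω ∈ cyl E m) (E : Set (Edge (Site d))) := by
  intro ω ω' hω
  have h : ∀ e ∈ E, ω e = ω' e := fun e he => hω e he
  simp only [cyl, Set.mem_ofPred_eq, eq_iff_iff]
  exact forall₂_congr fun e he => by rw [h e he]

lemma dependsOn_cyl_inter {S : Type*} [DecidableEq (Edge (Site d))] (E E' : Finset (Edge (Site d)))
    (m m' : Edge (Site d) → S) :
    DependsOn (fun ω => ω ∈ cyl E m ∩ cyl E' m') ((E ∪ E' : Finset _) : Set (Edge (Site d))) := by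
  intro ω ω' hω
  have h1 := dependsOn_cyl E m fun e he => hω e (by simp_all)
  have h2 := dependsOn_cyl E' m' fun e he => hω e (by simp_all)
  simp only [eq_iff_iff] at h1 h2
  simp only [Set.mem_inter_iff, h1, h2]

end Cylinders

/-! ### The infinite volume limit -/

section Limit

variable {d : ℕ} {J : Sym2 (Site d) → ℝ} {β : ℝ}

lemma abs_currentFactor_le (a : ℝ) (k : ℕ) (u : ℤˣ) :
    |currentFactor a k u| ≤ |a| ^ k / k ! * Real.exp |a| := by
  rw [currentFactor, abs_mul, abs_mul, abs_pow (sgn u), abs_sgn, one_pow, mul_one, abs_div, abs_pow,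
    Nat.abs_cast, Real.abs_exp]
  refine mul_le_mul_of_nonneg_left (Real.exp_le_exp.2 ?_) (by positivity)
  calc -(a * sgn u) ≤ |-(a * sgn u)| := le_abs_self _
    _ = |a| := by rw [abs_neg, abs_mul, abs_sgn, mul_one]

/-- The spin function is bounded pointwise independently of the volume and the field. Outside the
volume the current vanishes, hence the restriction to nonzero k. -/
lemma IsCurrentLaw.measure_eq_le {h : Site d → ℝ} {G : Finset (Site d)}
    {ν : Measure (Current (Site d))} (hν : IsCurrentLaw J β h G ν) (e : Edge (Site d)) {k : ℕ}
    (hk : k ≠ 0) :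
    ν {ω | ω e = k} ≤ ENNReal.ofReal (|β * J e.1| ^ k / k ! * Real.exp |β * J e.1|) := by
  by_cases he : e ∈ edgesIn G
  · have h1 : {ω : Current (Site d) | ω e = k} = cyl {e} fun _ => k := by
      ext; simp [cyl]
    rw [h1, (hν.cylinder _ _ (Finset.singleton_subset_iff.2 he)).2]
    refine ENNReal.ofReal_le_ofReal ((le_abs_self _).trans (abs_isingMean_le fun σ => ?_))
    rw [Finset.prod_singleton]
    exact abs_currentFactor_le _ _ _
  · refine (measure_mono_null ?_ (hν.support e he)).trans_le (zero_le)
    intro ω hω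
    change ω e ≠ 0
    rw [show ω e = k from hω]
    exact hk

lemma exists_tail_bound (e : Edge (Site d)) {ε : ENNReal} (hε : 0 < ε) :
    ∃ N : ℕ, ∀ (h : Site d → ℝ) (G : Finset (Site d)) (ν : Measure (Current (Site d))),
      IsCurrentLaw J β h G ν → ν {ω | N ≤ ω e} ≤ ε := by
  set f : ℕ → ENNReal := fun k =>
    ENNReal.ofReal (|β * J e.1| ^ k / k ! * Real.exp |β * J e.1|) with hf
  have hsum : ∑' k, f k ≠ ⊤ := by
    rw [hf, ← ENNReal.ofReal_tsum_of_nonneg (fun k => by positivity)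
      ((hasSum_pow_div_factorial _).summable.mul_right _)]
    exact ENNReal.ofReal_ne_top
  have h1 := (ENNReal.tendsto_sum_nat_add f hsum).eventually (gt_mem_nhds hε)
  obtain ⟨N, hN, hN1⟩ := (h1.and (eventually_ge_atTop 1)).exists
  refine ⟨N, fun h G ν hν => ?_⟩
  have h2 : {ω : Current (Site d) | N ≤ ω e} = ⋃ k : ℕ, {ω | ω e = k + N} := by
    ext ω
    simp only [Set.mem_ofPred_eq, Set.mem_iUnion]
    exact ⟨fun h => ⟨ω e - N, by omega⟩, fun ⟨k, hk⟩ => by omega⟩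
  rw [h2]
  refine (measure_iUnion_le _).trans (le_trans (ENNReal.tsum_le_tsum fun k => ?_) hN.le)
  exact hν.measure_eq_le e (by omega)

/-- There are countably many edges: give each a share of ε and cut off its current by the uniform
tail bound. The remaining set is a product of finite sets. -/
lemma isTightMeasureSet_currentLaw (S : Set (Measure (Current (Site d))))
    (hS : ∀ ν ∈ S, ∃ h G, IsCurrentLaw J β h G ν) : IsTightMeasureSet S := by
  rw [isTightMeasureSet_iff_exists_isCompact_measure_compl_le]
  intro ε hε
  obtain ⟨δ, hδ0, hδ⟩ := ENNReal.exists_pos_sum_of_countable hε.ne' (Edge (Site d))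
  choose N hN using fun e : Edge (Site d) =>
    exists_tail_bound (J := J) (β := β) e (ENNReal.coe_pos.2 (hδ0 e))
  refine ⟨Set.pi Set.univ fun e => Set.Iio (N e),
    isCompact_univ_pi fun e => (Set.finite_Iio _).isCompact, fun ν hν => ?_⟩
  obtain ⟨h, G, hν⟩ := hS ν hν
  have h1 : (Set.pi Set.univ fun e => Set.Iio (N e))ᶜ =
      ⋃ e, {ω : Current (Site d) | N e ≤ ω e} := by
    ext ω
    simp [Set.mem_pi]
  rw [h1]
  exact (measure_iUnion_le _).trans
    ((ENNReal.tsum_le_tsum fun e => hN e h G ν hν).trans hδ.le)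

variable {h : ℕ → Site d → ℝ} {ν : ℕ → Measure (Current (Site d))}

/-- Laws of currents whose cylinder probabilities converge have a limit. -/
lemma exists_limit_of_tendsto_cyl (hν : ∀ L, IsCurrentLaw J β (h L) (box d L) (ν L))
    (hlim : ∀ E m, ∃ q, Tendsto (fun L => ν L (cyl E m)) atTop (𝓝 q)) :
    ∃ μ : Measure (Current (Site d)), IsProbabilityMeasure μ ∧
      ∀ (E : Finset (Edge (Site d))) (A : Set (Current (Site d))),
        DependsOn (fun ω => ω ∈ A) (E : Set (Edge (Site d))) →
          Tendsto (fun L => ν L A) atTop (𝓝 (μ A)) := by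
  let ν' : ℕ → ProbabilityMeasure (Current (Site d)) := fun L => ⟨ν L, (hν L).isProbabilityMeasure⟩
  have hcomp : IsCompact (closure (Set.range ν')) := by
    refine isCompact_closure_of_isTightMeasureSet
      (isTightMeasureSet_currentLaw (J := J) (β := β) _ ?_)
    rintro _ ⟨_, ⟨L, rfl⟩, rfl⟩
    exact ⟨_, _, hν L⟩
  have hmem : ∀ᶠ L in atTop, ν' L ∈ closure (Set.range ν') :=
    Eventually.of_forall fun L => subset_closure ⟨L, rfl⟩
  have hclopen : ∀ (E : Finset (Edge (Site d))) (A : Set (Current (Site d))),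
      DependsOn (fun ω => ω ∈ A) (E : Set (Edge (Site d))) →
      ∀ (l : Filter ℕ) (μ : ProbabilityMeasure (Current (Site d))), Tendsto ν' l (𝓝 μ) →
        Tendsto (fun L => ν L A) l (𝓝 ((μ : Measure (Current (Site d))) A)) :=
    fun E A hA l μ hμ => ProbabilityMeasure.tendsto_measure_of_null_frontier_of_tendsto' hμ
      (by rw [(isClopen_of_dependsOn hA).frontier_eq, measure_empty])
  obtain ⟨μ, -, hμ⟩ := hcomp.exists_mapClusterPt_of_frequently hmem.frequently
  have huniq : ∀ μ' ∈ closure (Set.range ν'), MapClusterPt μ' atTop ν' → μ' = μ := by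
    intro μ' _ hμ'
    -- Cluster points are limits along ultrafilters finer than `atTop`, where the cylinder
    -- probabilities have the same limits.
    obtain ⟨U, hU, hUμ⟩ := mapClusterPt_iff_ultrafilter.1 hμ
    obtain ⟨U', hU', hUμ'⟩ := mapClusterPt_iff_ultrafilter.1 hμ'
    refine Subtype.ext (measure_eq_of_cyl (μ := (μ' : Measure (Current (Site d))))
      (μ' := (μ : Measure (Current (Site d)))) fun E m => ?_)
    obtain ⟨q, hq⟩ := hlim E m
    rw [tendsto_nhds_unique (hclopen E _ (dependsOn_cyl E m) _ _ hUμ) (hq.mono_left hU)]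
    exact tendsto_nhds_unique (hclopen E _ (dependsOn_cyl E m) _ _ hUμ') (hq.mono_left hU')
  have hT := hcomp.tendsto_nhds_of_unique_mapClusterPt hmem huniq
  exact ⟨μ, inferInstance, fun E A hA => hclopen E A hA _ _ hT⟩

end Limit

/-! ### Ergodicity -/

section Ergodic

/-- If the average of the indicators of the events `B y` has small variance, then it is almost
uncorrelated with every event. -/
lemma abs_measureReal_inter_sub_le {Ω ι : Type*} [MeasurableSpace Ω] {μ : Measure Ω}
    [IsProbabilityMeasure μ] {t : Finset ι} (ht : 0 < t.card) {B : ι → Set Ω}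
    (hB : ∀ y, MeasurableSet (B y)) {A : Set Ω} (hA : MeasurableSet A) {p q ε : ℝ} (hε : 0 < ε)
    (hp : ∀ y ∈ t, μ.real (B y) = p) (hq : ∀ y ∈ t, μ.real (A ∩ B y) = q)
    (hv : ∑ y ∈ t, ∑ z ∈ t, μ.real (B y ∩ B z) ≤ (t.card : ℝ) ^ 2 * (p ^ 2 + ε ^ 2)) :
    |q - μ.real A * p| ≤ 2 * ε := by
  set N : ℝ := (t.card : ℝ) with hN
  have hN0 : 0 < N := by rw [hN]; exact_mod_cast ht
  have hint : ∀ s : Set Ω, MeasurableSet s → Integrable (s.indicator (1 : Ω → ℝ)) μ := fun s hs =>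
    (integrable_const 1).indicator hs
  let g : Ω → ℝ := fun ω => N⁻¹ * ∑ y ∈ t, (B y).indicator 1 ω - p
  have hmul : ∀ (s s' : Set Ω) (ω : Ω), s.indicator (1 : Ω → ℝ) ω * s'.indicator 1 ω =
      (s ∩ s').indicator 1 ω := fun s s' ω => by
    rw [Set.inter_indicator_one]; rfl
  have hg2 : ∀ ω, g ω ^ 2 = (N⁻¹ ^ 2 * ∑ y ∈ t, ∑ z ∈ t, (B y ∩ B z).indicator 1 ω -
      2 * p * N⁻¹ * ∑ y ∈ t, (B y).indicator 1 ω) + p ^ 2 := by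
    intro ω
    simp_rw [← hmul, ← Finset.mul_sum, ← Finset.sum_mul, g]
    ring
  have hgA : ∀ ω, A.indicator 1 ω * g ω =
      N⁻¹ * ∑ y ∈ t, (A ∩ B y).indicator 1 ω - p * A.indicator 1 ω := by
    intro ω
    simp_rw [← hmul, ← Finset.mul_sum, g]
    ring
  have hi1 : Integrable (fun ω => ∑ y ∈ t, ∑ z ∈ t, (B y ∩ B z).indicator (1 : Ω → ℝ) ω) μ :=
    integrable_finsetSum _ fun y _ => integrable_finsetSum _ fun z _ =>
      hint _ ((hB y).inter (hB z))
  have hi2 : Integrable (fun ω => ∑ y ∈ t, (B y).indicator (1 : Ω → ℝ) ω) μ :=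
    integrable_finsetSum _ fun y _ => hint _ (hB y)
  have hi3 : Integrable (fun ω => ∑ y ∈ t, (A ∩ B y).indicator (1 : Ω → ℝ) ω) μ :=
    integrable_finsetSum _ fun y _ => hint _ (hA.inter (hB y))
  have hI2 : ∫ ω, ∑ y ∈ t, (B y).indicator (1 : Ω → ℝ) ω ∂μ = N * p := by
    rw [integral_finsetSum _ fun y _ => hint _ (hB y)]
    simp_rw [fun y => integral_indicator_one (μ := μ) (hB y)]
    rw [Finset.sum_congr rfl hp, Finset.sum_const, nsmul_eq_mul]
  have hI1 : ∫ ω, ∑ y ∈ t, ∑ z ∈ t, (B y ∩ B z).indicator (1 : Ω → ℝ) ω ∂μ =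
      ∑ y ∈ t, ∑ z ∈ t, μ.real (B y ∩ B z) := by
    rw [integral_finsetSum _ fun y _ => integrable_finsetSum _ fun z _ =>
      hint _ ((hB y).inter (hB z))]
    refine Finset.sum_congr rfl fun y _ => ?_
    rw [integral_finsetSum _ fun z _ => hint _ ((hB y).inter (hB z))]
    exact Finset.sum_congr rfl fun z _ => integral_indicator_one ((hB y).inter (hB z))
  have hI3 : ∫ ω, ∑ y ∈ t, (A ∩ B y).indicator (1 : Ω → ℝ) ω ∂μ = N * q := by
    rw [integral_finsetSum _ fun y _ => hint _ (hA.inter (hB y))]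
    simp_rw [fun y => integral_indicator_one (μ := μ) (hA.inter (hB y))]
    rw [Finset.sum_congr rfl hq, Finset.sum_const, nsmul_eq_mul]
  have hgi : Integrable (fun ω => g ω ^ 2) μ := by
    simp_rw [hg2]
    exact ((hi1.const_mul _).sub (hi2.const_mul _)).add (integrable_const _)
  have hgv : ∫ ω, g ω ^ 2 ∂μ ≤ ε ^ 2 := by
    simp_rw [hg2]
    have hi12 : Integrable (fun ω => N⁻¹ ^ 2 * ∑ y ∈ t, ∑ z ∈ t,
        (B y ∩ B z).indicator (1 : Ω → ℝ) ω -
          2 * p * N⁻¹ * ∑ y ∈ t, (B y).indicator (1 : Ω → ℝ) ω) μ :=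
      (hi1.const_mul _).sub (hi2.const_mul _)
    rw [integral_add hi12 (integrable_const _),
      integral_sub (hi1.const_mul _) (hi2.const_mul _), integral_const_mul, integral_const_mul,
      hI1, hI2, integral_const, probReal_univ, one_smul]
    have h1 : N⁻¹ ^ 2 * ∑ y ∈ t, ∑ z ∈ t, μ.real (B y ∩ B z) ≤ p ^ 2 + ε ^ 2 := by
      rw [inv_pow, inv_mul_le_iff₀ (by positivity)]
      exact hv
    have h2 : 2 * p * N⁻¹ * (N * p) = 2 * p ^ 2 := by field_simp
    rw [h2]
    linarith
  have hval : ∫ ω, A.indicator 1 ω * g ω ∂μ = q - μ.real A * p := by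
    simp_rw [hgA]
    rw [integral_sub (hi3.const_mul _) ((hint A hA).const_mul _), integral_const_mul,
      integral_const_mul, hI3, integral_indicator_one hA, inv_mul_cancel_left₀ hN0.ne', mul_comm p]
  rw [← hval]
  -- A pointwise substitute for the Cauchy–Schwarz inequality.
  have hpt : ∀ ω, |A.indicator 1 ω * g ω| ≤ ε + ε⁻¹ * g ω ^ 2 := by
    intro ω
    have h1 : |A.indicator (1 : Ω → ℝ) ω| ≤ 1 := by
      by_cases hω : ω ∈ A <;> simp [hω]
    have h2 : |g ω| ≤ ε + ε⁻¹ * g ω ^ 2 := by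
      rw [← sq_abs]
      have h3 : ε⁻¹ * |g ω| ^ 2 = |g ω| * (|g ω| / ε) := by field_simp
      rcases le_total |g ω| ε with h | h
      · have : 0 ≤ ε⁻¹ * |g ω| ^ 2 := by positivity
        linarith
      · rw [h3]
        have : 1 ≤ |g ω| / ε := (one_le_div hε).2 h
        nlinarith [abs_nonneg (g ω)]
    rw [abs_mul]
    nlinarith [abs_nonneg (g ω), abs_nonneg (A.indicator (1 : Ω → ℝ) ω)]
  calc |∫ ω, A.indicator 1 ω * g ω ∂μ| ≤ ∫ ω, |A.indicator 1 ω * g ω| ∂μ :=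
        abs_integral_le_integral_abs
    _ ≤ ∫ ω, (ε + ε⁻¹ * g ω ^ 2) ∂μ :=
        integral_mono_of_nonneg (Eventually.of_forall fun _ => abs_nonneg _)
          ((integrable_const _).add (hgi.const_mul _)) (Eventually.of_forall hpt)
    _ = ε + ε⁻¹ * ∫ ω, g ω ^ 2 ∂μ := by
        rw [integral_add (integrable_const _) (hgi.const_mul _), integral_const_mul, integral_const,
          probReal_univ, one_smul]
    _ ≤ ε + ε⁻¹ * ε ^ 2 := by gcongr
    _ = 2 * ε := by field_simp; ring

variable {d : ℕ} {J : Sym2 (Site d) → ℝ} {β : ℝ} {h : ℕ → Site d → ℝ}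
  {ν : ℕ → Measure (Current (Site d))} {Φ : Finset (Edge (Site d)) → ℝ}

lemma shift_zero {S : Type} (ω : Edge (Site d) → S) : shift 0 ω = ω := by
  funext e
  rw [shift]
  congr 1
  apply Subtype.ext
  have h : ((Equiv.addRight (0 : Site d)).toEmbedding : Site d → Site d) = id := by
    funext z
    simp
  change Sym2.map _ e.1 = e.1
  rw [h, Sym2.map_id, id]

lemma IsCurrentLaw.eventually_cyl_shift (hJ : IsCoupling J)
    (hν : ∀ L, IsCurrentLaw J β (h L) (box d L) (ν L)) (E : Finset (Edge (Site d)))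
    (m : Current (Site d)) (x : Site d) :
    ∀ᶠ L in atTop, ν L (shift x ⁻¹' cyl E m) =
      ENNReal.ofReal (isingMean J β (h L) (box d L) fun σ => cylFun J β E m (σ ∘ (· + x))) := by
  filter_upwards [(tendsto_box d).eventually (eventually_subset_edgesIn (shiftEdges x E))]
    with L hL
  rw [shift_preimage_cyl, ((hν L).cylinder _ _ hL).2]
  congr 2
  ext σ
  exact cylFun_shift hJ β E m x σ

/-- On disjoint edge sets the two prescriptions merge into one cylinder event, whose spin function
is the product of the two. -/
lemma IsCurrentLaw.eventually_cyl_inter_shift (hJ : IsCoupling J)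
    (hν : ∀ L, IsCurrentLaw J β (h L) (box d L) (ν L)) (E : Finset (Edge (Site d)))
    (m : Current (Site d)) {x y : Site d} (hxy : Disjoint (shiftEdges x E) (shiftEdges y E)) :
    ∀ᶠ L in atTop, (ν L).real (shift x ⁻¹' cyl E m ∩ shift y ⁻¹' cyl E m) =
      isingMean J β (h L) (box d L)
        fun σ => cylFun J β E m (σ ∘ (· + x)) * cylFun J β E m (σ ∘ (· + y)) := by
  classical
  filter_upwards [(tendsto_box d).eventually
    (eventually_subset_edgesIn (shiftEdges x E ∪ shiftEdges y E))] with L hL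
  let m' : Current (Site d) := fun e =>
    if e ∈ shiftEdges x E then shift (-x) m e else shift (-y) m e
  have hx : ∀ e ∈ shiftEdges x E, m' e = shift (-x) m e := fun e he => if_pos he
  have hy : ∀ e ∈ shiftEdges y E, m' e = shift (-y) m e :=
    fun e he => if_neg (Finset.disjoint_right.1 hxy he)
  have hm' : m' ∈ shift x ⁻¹' cyl E m ∩ shift y ⁻¹' cyl E m := by
    rw [shift_preimage_cyl, shift_preimage_cyl]
    exact ⟨hx, hy⟩
  rw [shift_preimage_cyl, shift_preimage_cyl] at hm' ⊢
  obtain ⟨h0, h1⟩ := (hν L).cylinder _ m' hL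
  rw [cyl_inter_eq hm', Measure.real, h1, ENNReal.toReal_ofReal h0]
  congr 1
  ext σ
  rw [Finset.prod_union hxy, ← cylFun_shift hJ, ← cylFun_shift hJ, cylFun, cylFun]
  congr 1
  · exact Finset.prod_congr rfl fun e he => by rw [hx e he]
  · exact Finset.prod_congr rfl fun e he => by rw [hy e he]

/-- The averages over distant translates of a cylinder event have small variance in the infinite
volume limit. -/
lemma exists_sum_measureReal_inter_le [Infinite (Site d)] (hJ : IsCoupling J)
    (hν : ∀ L, IsCurrentLaw J β (h L) (box d L) (ν L)) {μ : Measure (Current (Site d))}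
    [IsProbabilityMeasure μ]
    (hμ : ∀ (E : Finset (Edge (Site d))) (A : Set (Current (Site d))),
      DependsOn (fun ω => ω ∈ A) (E : Set (Edge (Site d))) →
        Tendsto (fun L => ν L A) atTop (𝓝 (μ A)))
    {E : Finset (Edge (Site d))} {m : Current (Site d)} {p : ℝ}
    (hp : ∀ x, Tendsto (fun L => isingMean J β (h L) (box d L)
      fun σ => cylFun J β E m (σ ∘ (· + x))) atTop (𝓝 p))
    (hconc : ∀ ε > 0, ∃ N₀ : ℕ, ∀ T : Finset (Site d), N₀ ≤ T.card →
        (T : Set (Site d)).PairwiseDisjoint (fun y => shiftEdges y E) →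
        ∀ᶠ L in atTop, isingMean J β (h L) (box d L)
          (fun σ => ((T.card : ℝ)⁻¹ * ∑ y ∈ T, cylFun J β E m (σ ∘ (· + y)) - p) ^ 2) ≤ ε)
    {ε : ℝ} (hε : 0 < ε) :
    ∃ T : Finset (Site d), 0 < T.card ∧
      ∑ y ∈ T, ∑ z ∈ T, μ.real (shift y ⁻¹' cyl E m ∩ shift z ⁻¹' cyl E m) ≤
        (T.card : ℝ) ^ 2 * (p ^ 2 + ε) := by
  classical
  obtain ⟨N₀, H⟩ := hconc (ε / 2) (by positivity)
  obtain ⟨N₁, hN₁⟩ := exists_nat_gt (2 / ε)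
  -- More than 2/ε translates make the diagonal contribution N at most N²ε/2.
  obtain ⟨T, hT, hd⟩ := exists_disjoint_shiftEdges E (N₀ + N₁ + 1)
  have hT0 : 0 < T.card := by omega
  refine ⟨T, hT0, ?_⟩
  set N : ℝ := (T.card : ℝ) with hN
  have hN0 : 0 < N := by rw [hN]; exact_mod_cast hT0
  have hN1 : 1 ≤ N * (ε / 2) := by
    have h1 : (N₁ : ℝ) ≤ N := by rw [hN, hT]; push_cast; linarith [Nat.cast_nonneg (α := ℝ) N₀]
    have h2 := (div_lt_iff₀ hε).1 (hN₁.trans_le h1)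
    linarith
  let F : Site d → (Site d → ℤˣ) → ℝ := fun y σ => cylFun J β E m (σ ∘ (· + y))
  have hlhs : Tendsto (fun L => ∑ y ∈ T, ∑ z ∈ T,
      (ν L).real (shift y ⁻¹' cyl E m ∩ shift z ⁻¹' cyl E m)) atTop
      (𝓝 (∑ y ∈ T, ∑ z ∈ T, μ.real (shift y ⁻¹' cyl E m ∩ shift z ⁻¹' cyl E m))) := by
    refine tendsto_finsetSum _ fun y _ => tendsto_finsetSum _ fun z _ => ?_
    refine (ENNReal.tendsto_toReal (measure_ne_top μ _)).comp (hμ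
      (shiftEdges y E ∪ shiftEdges z E) _ ?_)
    rw [shift_preimage_cyl, shift_preimage_cyl]
    exact dependsOn_cyl_inter _ _ _ _
  have hrhs : Tendsto (fun L => N + N ^ 2 * (ε / 2 + 2 * p * (N⁻¹ * ∑ y ∈ T,
      isingMean J β (h L) (box d L) (F y)) - p ^ 2)) atTop
      (𝓝 (N + N ^ 2 * (ε / 2 + 2 * p * (N⁻¹ * ∑ y ∈ T, p) - p ^ 2))) :=
    (((((tendsto_finsetSum T fun y _ => hp y).const_mul N⁻¹).const_mul (2 * p)).const_add
      (ε / 2)).sub_const (p ^ 2)).const_mul (N ^ 2) |>.const_add N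
  have hle : ∀ᶠ L in atTop, ∑ y ∈ T, ∑ z ∈ T,
      (ν L).real (shift y ⁻¹' cyl E m ∩ shift z ⁻¹' cyl E m) ≤
        N + N ^ 2 * (ε / 2 + 2 * p * (N⁻¹ * ∑ y ∈ T, isingMean J β (h L) (box d L) (F y)) -
          p ^ 2) := by
    have hpairs : ∀ᶠ L in atTop, ∀ y ∈ T, ∀ z ∈ T, y ≠ z →
        (ν L).real (shift y ⁻¹' cyl E m ∩ shift z ⁻¹' cyl E m) =
          isingMean J β (h L) (box d L) fun σ => F y σ * F z σ :=
      (eventually_all_finset T).2 fun y hy => (eventually_all_finset T).2 fun z hz => by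
        by_cases hyz : y = z
        · exact Eventually.of_forall fun _ h => absurd hyz h
        · exact (IsCurrentLaw.eventually_cyl_inter_shift hJ hν E m (hd hy hz hyz)).mono
            fun _ h _ => h
    filter_upwards [hpairs, H T (by omega) hd] with L h1 h2
    have := (hν L).isProbabilityMeasure
    -- The product formula fails on the diagonal; there the probability is bounded by 1, and the
    -- mean of a square is added for free.
    have h3 : ∀ y ∈ T, ∀ z ∈ T, (ν L).real (shift y ⁻¹' cyl E m ∩ shift z ⁻¹' cyl E m) ≤
        (if y = z then 1 else 0) + isingMean J β (h L) (box d L) fun σ => F y σ * F z σ := by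
      intro y hy z hz
      by_cases hyz : y = z
      · subst hyz
        have h4 : 0 ≤ isingMean J β (h L) (box d L) fun σ => F y σ * F y σ := by
          rw [← isingMean_const (J := J) (β := β) (h := h L) (G := box d L) 0]
          exact isingMean_mono fun σ => mul_self_nonneg _
        rw [if_pos rfl]
        linarith [measureReal_le_one (μ := ν L) (s := shift y ⁻¹' cyl E m ∩ shift y ⁻¹' cyl E m)]
      · rw [if_neg hyz, zero_add, h1 y hy z hz hyz]
    have h5 : isingMean J β (h L) (box d L) (fun σ => (N⁻¹ * ∑ y ∈ T, F y σ - p) ^ 2) =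
        N⁻¹ ^ 2 * (∑ y ∈ T, ∑ z ∈ T, isingMean J β (h L) (box d L) fun σ => F y σ * F z σ) -
          2 * p * (N⁻¹ * ∑ y ∈ T, isingMean J β (h L) (box d L) (F y)) + p ^ 2 := by
      have h6 : ∀ σ, (N⁻¹ * ∑ y ∈ T, F y σ - p) ^ 2 =
          (N⁻¹ ^ 2 * (∑ y ∈ T, ∑ z ∈ T, F y σ * F z σ) +
            (-(2 * p * N⁻¹)) * ∑ y ∈ T, F y σ) + p ^ 2 := by
        intro σ
        rw [← Finset.sum_mul_sum]
        ring
      simp_rw [h6]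
      rw [isingMean_add, isingMean_add, isingMean_const_mul, isingMean_const_mul, isingMean_const,
        isingMean_sum, isingMean_sum]
      simp_rw [isingMean_sum]
      ring
    rw [h5] at h2
    have h7 : ∑ y ∈ T, ∑ z ∈ T, (ν L).real (shift y ⁻¹' cyl E m ∩ shift z ⁻¹' cyl E m) ≤
        N + ∑ y ∈ T, ∑ z ∈ T, isingMean J β (h L) (box d L) fun σ => F y σ * F z σ := by
      refine (Finset.sum_le_sum fun y hy => Finset.sum_le_sum fun z hz => h3 y hy z hz).trans ?_
      simp only [Finset.sum_add_distrib, Finset.sum_ite_eq]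
      simp [hN]
    refine h7.trans (add_le_add_right ?_ N)
    rw [← inv_mul_le_iff₀ (by positivity), ← inv_pow]
    linarith
  refine (le_of_tendsto_of_tendsto hlhs hrhs hle).trans ?_
  rw [Finset.sum_const, nsmul_eq_mul, ← hN, inv_mul_cancel_left₀ hN0.ne']
  nlinarith [mul_le_mul_of_nonneg_left hN1 hN0.le]

/-- The laws of the currents in boxes converge to a translation invariant, ergodic law. -/
theorem exists_isErgodicLimit (hJ : IsCoupling J) (hΦ : IsSpinLimit J β h Φ)
    (hν : ∀ L, IsCurrentLaw J β (h L) (box d L) (ν L)) : ∃ μ, IsErgodicLimit ν μ := by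
  choose p hp hconc using fun E m => hΦ.exists_cylFun_limit hJ E m
  have hlim : ∀ E m x, Tendsto (fun L => ν L (shift x ⁻¹' cyl E m)) atTop
      (𝓝 (ENNReal.ofReal (p E m))) := fun E m x =>
    ((ENNReal.continuous_ofReal.tendsto _).comp (hp E m x)).congr'
      ((IsCurrentLaw.eventually_cyl_shift hJ hν E m x).mono fun _ h => h.symm)
  obtain ⟨μ, hμp, hμ⟩ := exists_limit_of_tendsto_cyl hν fun E m => ⟨_, by
    have := hlim E m 0
    rwa [show (shift 0 : Current (Site d) → _) = id from funext shift_zero] at this⟩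
  have hμcyl : ∀ E m x, μ (shift x ⁻¹' cyl E m) = ENNReal.ofReal (p E m) := fun E m x =>
    tendsto_nhds_unique (hμ (shiftEdges x E) _ (by
      rw [shift_preimage_cyl]; exact dependsOn_cyl _ _)) (hlim E m x)
  have hμcyl0 : ∀ E m, μ (cyl E m) = ENNReal.ofReal (p E m) := fun E m => by
    have := hμcyl E m 0
    rwa [show (shift 0 : Current (Site d) → _) = id from funext shift_zero] at this
  have hp0 : ∀ E m, 0 ≤ p E m := fun E m => by
    refine ge_of_tendsto (hp E m 0) ?_
    filter_upwards [(tendsto_box d).eventually (eventually_subset_edgesIn (shiftEdges 0 E))]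
      with L hL
    have := ((hν L).cylinder _ (shift (-0) m) hL).1
    simp_rw [← cylFun_shift hJ]
    exact this
  have hinv : ∀ x : Site d, MeasurePreserving (shift x) μ μ := fun x => by
    refine ⟨measurable_shift x, ?_⟩
    have := Measure.isProbabilityMeasure_map (μ := μ) (measurable_shift x).aemeasurable
    refine measure_eq_of_cyl fun E m => ?_
    rw [Measure.map_apply (measurable_shift x) (measurableSet_cyl E m), hμcyl, hμcyl0]
  refine ⟨μ, hμp, hμ, hinv, ?_⟩
  let := shiftAction d ℕ
  refine { measure_preimage_vadd := fun c s hs => (hinv c).measure_preimage hs.nullMeasurableSet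
           aeconst_of_forall_preimage_vadd_ae_eq := fun {A} hA hAinv => ?_ }
  have hind : ∀ E m, μ.real (A ∩ cyl E m) = μ.real A * μ.real (cyl E m) := by
    intro E m
    rcases E.eq_empty_or_nonempty with rfl | ⟨e, -⟩
    · simp [cyl]
    -- For d = 0 the lattice is a single point and has no edge.
    have hd : Infinite (Site d) := by
      rcases d with _ | d
      · obtain ⟨e, he⟩ := e
        induction e using Sym2.ind with
        | _ a b => exact absurd (Subsingleton.elim a b) (by rwa [Sym2.mk_isDiag_iff] at he)
      · infer_instance
    have hpr : μ.real (cyl E m) = p E m := by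
      rw [Measure.real, hμcyl0, ENNReal.toReal_ofReal (hp0 E m)]
    rw [← sub_eq_zero, ← abs_eq_zero]
    refine le_antisymm (le_of_forall_pos_le_add fun ε hε => ?_) (abs_nonneg _)
    obtain ⟨T, hT0, hT⟩ := exists_sum_measureReal_inter_le hJ hν hμ (hp E m) (hconc E m)
      (ε := (ε / 2) ^ 2) (by positivity)
    have key := abs_measureReal_inter_sub_le (μ := μ) hT0
      (B := fun y => shift y ⁻¹' cyl E m) (fun y => measurable_shift y (measurableSet_cyl E m))
      hA (p := p E m) (q := μ.real (A ∩ cyl E m)) (ε := ε / 2) (by positivity)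
      (fun y _ => by rw [Measure.real, hμcyl, ENNReal.toReal_ofReal (hp0 E m)])
      -- Invariance of `A` up to null sets makes its intersection with a translated cylinder event
      -- have the same probability for every translate.
      (fun y _ => by
        rw [Measure.real, Measure.real, ← (hinv y).measure_preimage
          (hA.inter (measurableSet_cyl E m)).nullMeasurableSet, Set.preimage_inter]
        congr 1
        exact measure_congr ((hAinv y).symm.inter (ae_eq_refl _))) hT
    rw [hpr]
    linarith
  -- Independence extends from the π-system of cylinder events to all events; evaluated at `A` it
  -- gives μ(A) = μ(A)².
  have hres : μ.restrict A = μ A • μ := by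
    refine ext_of_generate_finite _ generateFrom_cylinders isPiSystem_cylinders ?_ ?_
    · rintro _ ⟨E, m, rfl⟩
      rw [Measure.restrict_apply (measurableSet_cyl E m), Set.inter_comm, Measure.smul_apply,
        smul_eq_mul, ← ENNReal.toReal_eq_toReal_iff' (measure_ne_top _ _)
        (ENNReal.mul_ne_top (measure_ne_top _ _) (measure_ne_top _ _)), ENNReal.toReal_mul]
      exact hind E m
    · simp
  have hsq : μ.real A = μ.real A * μ.real A := by
    have := congrArg (fun ρ => (ρ A).toReal) hres
    simpa [Measure.real, Measure.restrict_apply hA] using this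
  rw [eventuallyConst_set']
  have hmul : μ.real A * (μ.real A - 1) = 0 := by linear_combination -hsq
  rcases mul_eq_zero.1 hmul with h0 | h1
  · left
    rw [ae_eq_empty]
    exact (measureReal_eq_zero_iff).1 h0
  · right
    rw [ae_eq_univ, ← measureReal_eq_zero_iff, probReal_compl_eq_one_sub hA, sub_eq_zero.1 h1, sub_self]

/-! ### Traces -/

lemma measurable_trace {V : Type} : Measurable (trace : Current V → Percolation V) :=
  measurable_pi_lambda _ fun e =>
    (measurable_of_countable fun k : ℕ => decide (0 < k)).comp (measurable_pi_apply e)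

/-- The trace acts edge by edge, so it commutes with shifts and pulls local events back to local
events and invariant events back to invariant ones. -/
lemma IsErgodicLimit.map_trace {μ : Measure (Current (Site d))} (hμ : IsErgodicLimit ν μ) :
    IsErgodicLimit (fun L => (ν L).map trace) (μ.map trace) := by
  have hcomm : ∀ (x : Site d) (ω : Current (Site d)), shift x (trace ω) = trace (shift x ω) :=
    fun _ _ => rfl
  have := hμ.isProbability
  have hinv : ∀ x : Site d, MeasurePreserving (shift x) (μ.map trace) (μ.map trace) := fun x => by
    refine ⟨measurable_shift x, ?_⟩
    rw [Measure.map_map (measurable_shift x) measurable_trace,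
      show (shift x ∘ trace : Current (Site d) → _) = trace ∘ shift x from funext (hcomm x),
      ← Measure.map_map measurable_trace (measurable_shift x), (hμ.invariance x).map_eq]
  refine ⟨Measure.isProbabilityMeasure_map measurable_trace.aemeasurable, fun E A hA => ?_, hinv, ?_⟩
  · have hAm : MeasurableSet A := (isClopen_of_dependsOn hA).isOpen.measurableSet
    simp_rw [Measure.map_apply measurable_trace hAm]
    refine hμ.convergence E _ fun ω ω' h => ?_
    exact hA fun e he => by simp only [trace, h e he]
  · let := shiftAction d Bool
    let := shiftAction d ℕ
    have herg : ErgodicVAdd (Site d) (Current (Site d)) μ := hμ.ergodicity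
    refine { measure_preimage_vadd := fun c s hs => (hinv c).measure_preimage hs.nullMeasurableSet
             aeconst_of_forall_preimage_vadd_ae_eq := fun {A} hA hAinv => ?_ }
    have h1 := herg.aeconst_of_forall_preimage_vadd_ae_eq (measurable_trace hA) fun x =>
      (measurable_trace.measurePreserving μ).quasiMeasurePreserving.preimage_ae_eq (hAinv x)
    rw [eventuallyConst_set'] at h1 ⊢
    refine h1.imp (fun h => ?_) fun h => ?_
    · rw [ae_eq_empty] at h ⊢
      rwa [Measure.map_apply measurable_trace hA]
    · rw [ae_eq_univ] at h ⊢
      rwa [Measure.map_apply measurable_trace hA.compl]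

end Ergodic

end RandomCurrent

end

theorem theorem2p2 (d : ℕ) (J : Sym2 (RandomCurrent.Site d) → ℝ)
    (hJ : RandomCurrent.IsCoupling J) (β : ℝ) (hβ : 0 < β) :
    ∃ P_plus P_free : Measure (RandomCurrent.Current (RandomCurrent.Site d)),
      (RandomCurrent.IsErgodicLimit (RandomCurrent.plusBoxLaw J β) P_plus ∧
        RandomCurrent.IsErgodicLimit (RandomCurrent.freeBoxLaw J β) P_free) ∧
      (RandomCurrent.IsErgodicLimit
          (fun L => (RandomCurrent.plusBoxLaw J β L).map RandomCurrent.trace)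
          (P_plus.map RandomCurrent.trace) ∧
        RandomCurrent.IsErgodicLimit
          (fun L => (RandomCurrent.freeBoxLaw J β L).map RandomCurrent.trace)
          (P_free.map RandomCurrent.trace)) := by
  obtain ⟨Φ, hΦ⟩ := RandomCurrent.exists_isSpinLimit_plus hJ hβ
  obtain ⟨Ψ, hΨ⟩ := RandomCurrent.exists_isSpinLimit_free hJ hβ
  obtain ⟨P, hP⟩ := RandomCurrent.exists_isErgodicLimit (ν := RandomCurrent.plusBoxLaw J β) hJ hΦ
    fun L => RandomCurrent.isCurrentLaw_plus hJ.nonneg' hβ.le _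
  obtain ⟨Q, hQ⟩ := RandomCurrent.exists_isErgodicLimit (ν := RandomCurrent.freeBoxLaw J β) hJ hΨ
    fun L => RandomCurrent.isCurrentLaw_free hJ.nonneg' hβ.le _
  exact ⟨P, Q, ⟨hP, hQ⟩, hP.map_trace, hQ.map_trace⟩
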